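/- Let $M$ be a smooth $n$-manifold (without boundary, modelled on $\mathbb{R}^n$). Manifolds, maps and sections are of class $C^\infty$. **Notation.** $FM\to M$ is the bundle of linear frames $X:\mathbb{R}^n\to T_xM$ (linear isomorphisms), with the right action of $Gl(n,\mathbb{R})$. A local diffeomorphism $\psi:U\to V$ induces $F\psi: FU\to FV$, $F\psi(X)=T\psi\circ X$. Put $e_1=\mathrm{id}_{\mathbb{R}^n}$, a frame of $\mathbb{R}^n$ at $0$, and let $\tau_v$ be the translation of $\mathbb{R}^n$ by $v$. By a local isomorphism of frame bundles we mean a $Gl(n,\mathbb{R})$-equivariant diffeomorphism $\Psi: FU\to FV$, $U$, $V$ open. * $\overline F^2M$, the non-holonomic frame bundle of second order, has as fibre over $x\in M$ the set of $1$-jets $j^1_{e_1,\Psi(e_1)}\Psi$ of local isomorphisms $\Psi$ from $F\mathbb{R}^n$ to $FM$ whose induced map on the base maps $0$ to $x$. * $\Pi^1(M,M)$ is the groupoid over $M$ of $1$-jets of local diffeomorphisms of $M$, that is, of linear isomorphisms $T_xM\to T_yM$. * $\tilde J^1(FM)$ is the groupoid over $M$ whose elements $j^1_{x,y}\Psi$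 from $x$ to $y$ are the classes modulo $Gl(n,\mathbb{R})$ of $1$-jets, at the frames over $x$, of local isomorphisms $\Psi$ from $FM$ to $FM$ whose induced map on the base maps $x$ to $y$. * In either groupoid, a section is a map assigning to each $(x,y)\in M\times M$ an element from $x$ to $y$. A section $\mathcal S$ is a *morphism* (of Lie groupoids, over the identity of $M$, from the pair groupoid $M\times M$) if it is smooth and $\mathcal S(y,z)\cdot\mathcal S(x,y)=\mathcal S(x,z)$ for all $x,y,z\in M$. For smooth sections $P,Q$ of $FM$, write $Q(x)=j^1_{0,x}\psi_x$. The prolongation $P^1(Q)$ is the section of $\overline F^2M$ with $$P^1(Q)(x)=j^1_{e_1,P(x)}\bigl(X\mapsto P(\psi_x(v))\circ X\bigr)\qquad(X\text{ a frame of }\mathbb{R}^n\text{ at }v,\ T_v\mathbb{R}^n=\mathbb{R}^n).$$ For smooth sections $\mathcal P,\mathcal Q$ of $\Pi^1(M,M)$, write $\mathcal Q(x,y)=j^1_{x,y}\psi_{xy}$. The prolongation $\mathcal P^1(\mathcal Q)$ is the section of $\tilde J^1(FM)$ with $$\mathcal P^1(\mathcal Q)(x,y)=j^1_{x,y}\bigl(X\mapsto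 \mathcal P(v,\psi_{xy}(v))\circ X\bigr)\qquad(X\text{ a frame of }M\text{ at }v).$$ Neither depends on the choice of $\psi_x$, $\psi_{xy}$. For a section $\overline P$ of $\overline F^2M$ put $\overline{\mathcal G}\,\overline P(x,y)=\overline P(y)\cdot\overline P(x)^{-1}\in\tilde J^1(FM)$. **Integrability.** * A section $Q$ of $FM$ (respectively $\overline P$ of $\overline F^2M$) is *integrable* if near each point of $M$ there is a local chart $\psi$ such that, for all $x$ in its domain, $Q(x)=j^1_{0,x}(\psi^{-1}\circ\tau_{\psi(x)})$ (respectively $\overline P(x)=j^1_{e_1}F(\psi^{-1}\circ\tau_{\psi(x)})$). * A section $\mathcal Q$ of $\Pi^1(M,M)$ (respectively $\overline{\mathcal P}$ of $\tilde J^1(FM)$) is *integrable* if it is a parallelism, i.e. a morphism, and if for all $x_0,y_0\in M$ there are local charts $\psi$ around $x_0$ and $\varphi$ around $y_0$ such that, for all $x$ in the domain of $\psi$ and $y$ in the domain of $\varphi$, $\mathcal Q(x,y)=j^1_{x,y}(\varphi^{-1}\circ\tau_{\varphi(y)-\psi(x)}\circ\psi)$ (respectively $\overline{\mathcal P}(x,y)=j^1_{x,y}F(\varphi^{-1}\circ\tau_{\varphi(y)-\psi(x)}\circ\psi)$).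 * $P^1(Q)$ (respectively $\mathcal P^1(\mathcal Q)$) is an *integrable prolongation* if $Q$ (respectively $\mathcal Q$) is integrable. **Theorem.** Let $\mathcal P,\mathcal Q$ be smooth sections of $\Pi^1(M,M)$. 1. There are smooth sections $P,Q$ of $FM$ with $\overline{\mathcal G}P^1(Q)=\mathcal P^1(\mathcal Q)$ if and only if $\mathcal P$ and $\mathcal Q$ are morphisms of Lie groupoids from the pair groupoid $M\times M$ to $\Pi^1(M,M)$. 2. If $\mathcal P^1(\mathcal Q)$ is an integrable section of $\tilde J^1(FM)$, then there are smooth sections $P,Q$ of $FM$ such that $P^1(Q)$ is an integrable section of $\overline F^2M$ and $\overline{\mathcal G}P^1(Q)=\mathcal P^1(\mathcal Q)$. 3. If $\mathcal P^1(\mathcal Q)$ is an integrable prolongation, then there are smooth sections $P,Q$ of $FM$ such that $P^1(Q)$ is an integrable prolongation and $\overline{\mathcal G}P^1(Q)=\mathcal P^1(\mathcal Q)$ if and only if $\mathcal P$ is a morphism of Lie groupoids from the pair groupoid $M\times M$ to $\Pi^1(M,M)$. -/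

import Mathlib

open scoped Manifold ContDiff Topology
open Bundle

noncomputable section

/-- The model space `ℝⁿ`. -/
abbrev Rn (n : ℕ) : Type := EuclideanSpace ℝ (Fin n)

/-- The total space of the vector bundle over `M` with fibres `Hom(ℝⁿ, T_xM)`. -/
abbrev HomBundle (n : ℕ) (M : Type*) [TopologicalSpace M] [ChartedSpace (Rn n) M]
    [IsManifold (𝓡 n) ∞ M] : Type _ :=
  TotalSpace (Rn n →L[ℝ] Rn n) (fun x : M => Trivial M (Rn n) x →L[ℝ] TangentSpace (𝓡 n) x)

/-- The model with corners of the frame bundle, with coordinates `(x^i, x^i_j)`. -/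
abbrev frameModel (n : ℕ) := (𝓡 n).prod 𝓘(ℝ, Rn n →L[ℝ] Rn n)

set_option linter.unusedSectionVars false

section helpers

variable {n : ℕ} {M : Type*} [TopologicalSpace M] [ChartedSpace (Rn n) M] [IsManifold (𝓡 n) ∞ M]
  {N : Type*} [TopologicalSpace N] [ChartedSpace (Rn n) N] [IsManifold (𝓡 n) ∞ N]

theorem inCoordinates_trivial_source (x₀ x : M) (y₀ y : N)
    (A : Trivial M (Rn n) x →L[ℝ] TangentSpace (𝓡 n) y) :
    ContinuousLinearMap.inCoordinates (Rn n) (Trivial M (Rn n)) (Rn n)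
      (TangentSpace (𝓡 n) : N → Type) x₀ x y₀ y A
      = ((trivializationAt (Rn n) (TangentSpace (𝓡 n)) y₀).continuousLinearMapAt ℝ y).comp A := by
  ext v
  simp [ContinuousLinearMap.inCoordinates]

theorem comp_isInvertible_iff {x₀ x : M}
    (hx : x ∈ (trivializationAt (Rn n) (TangentSpace (𝓡 n)) x₀).baseSet)
    (A : Trivial M (Rn n) x →L[ℝ] TangentSpace (𝓡 n) x) :
    (((trivializationAt (Rn n) (TangentSpace (𝓡 n)) x₀).continuousLinearMapAt ℝ x).comp
      A).IsInvertible ↔ A.IsInvertible := by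
  have : ((trivializationAt (Rn n) (TangentSpace (𝓡 n)) x₀).continuousLinearMapAt ℝ x)
      = ((trivializationAt (Rn n) (TangentSpace (𝓡 n)) x₀).continuousLinearEquivAt ℝ x hx :
        TangentSpace (𝓡 n) x →L[ℝ] Rn n) := by
    ext1 v
    exact congrFun (Trivialization.coe_linearMapAt_of_mem (R := ℝ) _ hx) v
  rw [this]
  exact ContinuousLinearMap.isInvertible_equiv_comp

theorem isOpen_frames : IsOpen {X : HomBundle n M | X.2.IsInvertible} := by
  rw [isOpen_iff_mem_nhds]
  intro X₀ hX₀
  have h := ((contMDiffAt_hom_bundle (IB := 𝓡 n) (IM := frameModel n) (n := ∞)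
    (fun X : HomBundle n M => X) (x₀ := X₀)).1 contMDiffAt_id)
  have hb : ∀ᶠ X in 𝓝 X₀, X.1 ∈ (trivializationAt (Rn n) (TangentSpace (𝓡 n)) X₀.1).baseSet :=
    h.1.continuousAt ((trivializationAt (Rn n) (TangentSpace (𝓡 n)) X₀.1).open_baseSet.mem_nhds
      (FiberBundle.mem_baseSet_trivializationAt' X₀.1))
  have hc := h.2.continuousAt
  simp only [inCoordinates_trivial_source] at hc
  have hinv : (((trivializationAt (Rn n) (TangentSpace (𝓡 n)) X₀.1).continuousLinearMapAt ℝ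
      X₀.1).comp X₀.2) ∈ Set.range
        (ContinuousLinearEquiv.toContinuousLinearMap : (Rn n ≃L[ℝ] Rn n) → _) :=
    (comp_isInvertible_iff (FiberBundle.mem_baseSet_trivializationAt' X₀.1) X₀.2).2 hX₀
  filter_upwards [hb, hc (ContinuousLinearEquiv.isOpen.mem_nhds hinv)] with X hX hX'
  exact (comp_isInvertible_iff hX X.2).1 hX'

end helpers

/-- The frame bundle `FM`: linear frames `ℝⁿ ≃ T_xM`, as an open submanifold of the total space of
`Hom(ℝⁿ, TM)`. -/
def frames (n : ℕ) (M : Type*) [TopologicalSpace M] [ChartedSpace (Rn n) M]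
    [IsManifold (𝓡 n) ∞ M] : TopologicalSpace.Opens (HomBundle n M) :=
  ⟨{X | X.2.IsInvertible}, isOpen_frames⟩

/-- The frame bundle `FM` as a manifold. -/
abbrev FrameBundle (n : ℕ) (M : Type*) [TopologicalSpace M] [ChartedSpace (Rn n) M]
    [IsManifold (𝓡 n) ∞ M] : Type _ :=
  frames n M

namespace FrameBundle

variable {n : ℕ} {M : Type*} [TopologicalSpace M] [ChartedSpace (Rn n) M] [IsManifold (𝓡 n) ∞ M]
  {N : Type*} [TopologicalSpace N] [ChartedSpace (Rn n) N] [IsManifold (𝓡 n) ∞ N]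

/-- The projection `π_M : FM → M`. -/
def proj (X : FrameBundle n M) : M := X.1.1

/-- A frame at `x`, as a linear isomorphism `ℝⁿ ≃ T_xM`. -/
def toEquiv (X : FrameBundle n M) : Rn n ≃L[ℝ] TangentSpace (𝓡 n) X.proj :=
  Classical.choose (show X.1.2.IsInvertible from X.2)

/-- The frame at `x` given by a linear isomorphism `ℝⁿ ≃ T_xM`. -/
def mk (x : M) (e : Rn n ≃L[ℝ] TangentSpace (𝓡 n) x) : FrameBundle n M :=
  ⟨⟨x, (e : Rn n →L[ℝ] TangentSpace (𝓡 n) x)⟩, ⟨e, rfl⟩⟩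

theorem toEquiv_coe (X : FrameBundle n M) :
    (X.toEquiv : Rn n →L[ℝ] TangentSpace (𝓡 n) X.proj) = X.1.2 :=
  Classical.choose_spec (show X.1.2.IsInvertible from X.2)

@[simp] theorem mk_toEquiv (X : FrameBundle n M) : mk X.proj X.toEquiv = X := by
  apply Subtype.ext
  show (⟨X.1.1, _⟩ : HomBundle n M) = X.1
  rw [toEquiv_coe]

@[simp] theorem proj_mk (x : M) (e : Rn n ≃L[ℝ] TangentSpace (𝓡 n) x) : (mk x e).proj = x := rfl

@[simp] theorem toEquiv_mk (x : M) (e : Rn n ≃L[ℝ] TangentSpace (𝓡 n) x) :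
    (mk x e).toEquiv = e := by
  have := toEquiv_coe (mk x e)
  exact ContinuousLinearEquiv.coe_injective this

/-- The right action of `Gl(n, ℝ)` on `FM`. -/
def act (X : FrameBundle n M) (g : Rn n ≃L[ℝ] Rn n) : FrameBundle n M :=
  mk X.proj (g.trans X.toEquiv)

@[simp] theorem toEquiv_act (X : FrameBundle n M) (g : Rn n ≃L[ℝ] Rn n) :
    (X.act g).toEquiv = g.trans X.toEquiv := toEquiv_mk _ _

@[simp] theorem proj_act (X : FrameBundle n M) (g : Rn n ≃L[ℝ] Rn n) : (X.act g).proj = X.proj :=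
  rfl

theorem act_symm_act (X : FrameBundle n M) (g : Rn n ≃L[ℝ] Rn n) : (X.act g.symm).act g = X := by
  conv_rhs => rw [← mk_toEquiv X]
  rw [act, toEquiv_act]
  show mk X.proj _ = mk X.proj _
  congr 1
  exact ContinuousLinearEquiv.ext (funext fun v => congrArg X.toEquiv (g.symm_apply_apply v))

theorem exists_act_eq {X Y : FrameBundle n M} (h : X.proj = Y.proj) :
    ∃ g : Rn n ≃L[ℝ] Rn n, X.act g = Y := by
  have key : ∀ (x y : M) (a : Rn n ≃L[ℝ] TangentSpace (𝓡 n) x)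
      (b : Rn n ≃L[ℝ] TangentSpace (𝓡 n) y), x = y →
      ∃ g : Rn n ≃L[ℝ] Rn n, (mk x a).act g = mk y b := by
    rintro x _ a b rfl
    refine ⟨b.trans a.symm, ?_⟩
    rw [act, toEquiv_mk]
    congr 1
    exact ContinuousLinearEquiv.ext (funext fun v => a.apply_symm_apply (b v))
  simpa using key _ _ X.toEquiv Y.toEquiv h

/-- Smooth maps into `FM`. -/
theorem contMDiffAt_iff {E' H' K : Type*} [NormedAddCommGroup E'] [NormedSpace ℝ E']
    [TopologicalSpace H'] {I' : ModelWithCorners ℝ E' H'} [TopologicalSpace K] [ChartedSpace H' K]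
    {f : K → FrameBundle n M} {k : K} :
    ContMDiffAt I' (frameModel n) ∞ f k ↔
      ContMDiffAt I' (𝓡 n) ∞ (fun a => (f a).proj) k ∧
      ContMDiffAt I' 𝓘(ℝ, Rn n →L[ℝ] Rn n) ∞ (fun a =>
        ((trivializationAt (Rn n) (TangentSpace (𝓡 n)) (f k).proj).continuousLinearMapAt ℝ
          (f a).proj).comp ((f a).toEquiv : Rn n →L[ℝ] TangentSpace (𝓡 n) (f a).proj)) k := by
  rw [← ContMDiffAt.subtypeVal_comp_iff, contMDiffAt_hom_bundle]
  simp only [inCoordinates_trivial_source]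
  simp only [toEquiv_coe]
  rfl

theorem contMDiff_proj : ContMDiff (frameModel n) (𝓡 n) ∞ (proj : FrameBundle n M → M) :=
  fun _ => (contMDiffAt_iff.1 contMDiffAt_id).1

theorem contMDiff_act (g : Rn n ≃L[ℝ] Rn n) :
    ContMDiff (frameModel n) (frameModel n) ∞ (fun X : FrameBundle n M => X.act g) := by
  intro X
  have h := contMDiffAt_iff.1 (contMDiffAt_id (I := frameModel n) (x := X) (n := ∞))
  refine contMDiffAt_iff.2 ⟨h.1, ?_⟩
  have := h.2.clm_comp (contMDiffAt_const (c := (g : Rn n →L[ℝ] Rn n)))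
  refine this.congr_of_eventuallyEq (Filter.Eventually.of_forall fun Y => ?_)
  simp only [toEquiv_act]
  rfl
end FrameBundle


/-- Local diffeomorphisms between open subsets of two `n`-manifolds. -/
abbrev LocalDiffeo (n : ℕ) (M N : Type*) [TopologicalSpace M] [ChartedSpace (Rn n) M]
    [TopologicalSpace N] [ChartedSpace (Rn n) N] : Type _ :=
  PartialDiffeomorph (𝓡 n) (𝓡 n) M N ∞

/-- Local isomorphisms of principal bundles `FU → FV` between frame bundles inducing the identity
on `Gl(n, ℝ)`: local diffeomorphisms `Ψ` with invariant domain and `Ψ (X · g) = Ψ X · g`. -/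
structure LocalFrameIso (n : ℕ) (M N : Type*) [TopologicalSpace M] [ChartedSpace (Rn n) M]
    [IsManifold (𝓡 n) ∞ M] [TopologicalSpace N] [ChartedSpace (Rn n) N] [IsManifold (𝓡 n) ∞ N]
    extends PartialDiffeomorph (frameModel n) (frameModel n) (FrameBundle n M) (FrameBundle n N) ∞
    where
  act_mem : ∀ X ∈ source, ∀ g : Rn n ≃L[ℝ] Rn n, X.act g ∈ source
  map_act : ∀ X ∈ source, ∀ g : Rn n ≃L[ℝ] Rn n, toFun (X.act g) = (toFun X).act g

namespace LocalFrameIso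

variable {n : ℕ} {M : Type*} [TopologicalSpace M] [ChartedSpace (Rn n) M] [IsManifold (𝓡 n) ∞ M]
  {N : Type*} [TopologicalSpace N] [ChartedSpace (Rn n) N] [IsManifold (𝓡 n) ∞ N]
  {L : Type*} [TopologicalSpace L] [ChartedSpace (Rn n) L] [IsManifold (𝓡 n) ∞ L]

/-- Inverse. -/
def symm (Ψ : LocalFrameIso n M N) : LocalFrameIso n N M where
  toPartialDiffeomorph := Ψ.toPartialDiffeomorph.symm
  act_mem Y hY g := by
    have h := Ψ.map_act _ (Ψ.map_target hY) g
    rw [Ψ.right_inv hY] at h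
    show Y.act g ∈ Ψ.target
    rw [← h]
    exact Ψ.map_source (Ψ.act_mem _ (Ψ.map_target hY) g)
  map_act Y hY g := by
    have h := Ψ.map_act _ (Ψ.map_target hY) g
    rw [Ψ.right_inv hY] at h
    show Ψ.invFun (Y.act g) = (Ψ.invFun Y).act g
    rw [← h]
    exact Ψ.left_inv (Ψ.act_mem _ (Ψ.map_target hY) g)

/-- Composition `Φ ∘ Ψ`. -/
def comp (Φ : LocalFrameIso n N L) (Ψ : LocalFrameIso n M N) : LocalFrameIso n M L where
  toPartialDiffeomorph := Ψ.toPartialDiffeomorph.trans Φ.toPartialDiffeomorph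
  act_mem X hX g := by
    refine ⟨Ψ.act_mem X hX.1 g, ?_⟩
    show Ψ.toFun (X.act g) ∈ Φ.source
    rw [Ψ.map_act X hX.1 g]
    exact Φ.act_mem _ hX.2 g
  map_act X hX g := by
    show Φ.toFun (Ψ.toFun (X.act g)) = (Φ.toFun (Ψ.toFun X)).act g
    rw [Ψ.map_act X hX.1 g]
    exact Φ.map_act _ hX.2 g

/-- `Ψ` is defined at (the frames at) `x` and the induced map `ψ` on the base maps `x` to `y`. -/
def IsOver (Ψ : LocalFrameIso n M N) (x : M) (y : N) : Prop :=
  ∀ X : FrameBundle n M, X.proj = x → X ∈ Ψ.source ∧ (Ψ.toFun X).proj = y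

theorem IsOver.comp {Φ : LocalFrameIso n N L} {Ψ : LocalFrameIso n M N} {x : M} {y : N} {z : L}
    (hΦ : Φ.IsOver y z) (hΨ : Ψ.IsOver x y) : (Φ.comp Ψ).IsOver x z := by
  intro X hX
  have h1 := hΨ X hX
  have h2 := hΦ _ h1.2
  exact ⟨⟨h1.1, h2.1⟩, h2.2⟩

theorem IsOver.symm {Ψ : LocalFrameIso n M N} {x : M} {y : N} (h : Ψ.IsOver x y) :
    Ψ.symm.IsOver y x := by
  intro Y hY
  have hX := h (FrameBundle.mk x (ContinuousLinearEquiv.refl ℝ (Rn n))) rfl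
  obtain ⟨g, hg⟩ := FrameBundle.exists_act_eq (hX.2.trans hY.symm)
  rw [← Ψ.map_act _ hX.1] at hg
  rw [← hg]
  refine ⟨Ψ.map_source (Ψ.act_mem _ hX.1 g), ?_⟩
  show (Ψ.invFun (Ψ.toFun _)).proj = x
  rw [Ψ.left_inv' (Ψ.act_mem _ hX.1 g)]
  rfl

/-- Equality `j¹_{X,Ψ(X)} Ψ = j¹_{X,Ψ'(X)} Ψ'` of the `1`-jets at the frame `X`: equality of the
values and of the tangent maps. -/
def SameJetAt (X : FrameBundle n M) (Ψ Ψ' : LocalFrameIso n M N) : Prop :=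
  ∀ v : TangentSpace (frameModel n) X,
    tangentMap (frameModel n) (frameModel n) Ψ.toFun ⟨X, v⟩ =
      tangentMap (frameModel n) (frameModel n) Ψ'.toFun ⟨X, v⟩

theorem SameJetAt.map_eq {X : FrameBundle n M} {Ψ Ψ' : LocalFrameIso n M N}
    (h : SameJetAt X Ψ Ψ') : Ψ.toFun X = Ψ'.toFun X :=
  congrArg TotalSpace.proj (h 0)

theorem mdifferentiableAt (Ψ : LocalFrameIso n M N) {X : FrameBundle n M} (hX : X ∈ Ψ.source) :
    MDifferentiableAt (frameModel n) (frameModel n) Ψ.toFun X :=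
  Ψ.toPartialDiffeomorph.mdifferentiableAt (by simp) hX

theorem tangentMap_comp {Φ : LocalFrameIso n N L} {Ψ : LocalFrameIso n M N} {X : FrameBundle n M}
    (hX : X ∈ Ψ.source) (hY : Ψ.toFun X ∈ Φ.source) (v : TangentSpace (frameModel n) X) :
    tangentMap (frameModel n) (frameModel n) (Φ.comp Ψ).toFun ⟨X, v⟩ =
      tangentMap (frameModel n) (frameModel n) Φ.toFun
        (tangentMap (frameModel n) (frameModel n) Ψ.toFun ⟨X, v⟩) :=
  tangentMap_comp_at (I' := frameModel n) (⟨X, v⟩ : TangentBundle (frameModel n) (FrameBundle n M))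
    (Φ.mdifferentiableAt hY) (Ψ.mdifferentiableAt hX)

theorem SameJetAt.comp {Φ Φ' : LocalFrameIso n N L} {Ψ Ψ' : LocalFrameIso n M N}
    {X : FrameBundle n M} (h : SameJetAt X Ψ Ψ') (h' : SameJetAt (Ψ.toFun X) Φ Φ')
    (hX : X ∈ Ψ.source) (hX' : X ∈ Ψ'.source) (hY : Ψ.toFun X ∈ Φ.source)
    (hY' : Ψ.toFun X ∈ Φ'.source) : SameJetAt X (Φ.comp Ψ) (Φ'.comp Ψ') := by
  intro v
  rw [tangentMap_comp hX hY, tangentMap_comp hX' (h.map_eq ▸ hY'), ← h v]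
  exact h' _

theorem SameJetAt.apply {Ψ Ψ' : LocalFrameIso n M N} {X : FrameBundle n M}
    (h : SameJetAt X Ψ Ψ') (p : TangentBundle (frameModel n) (FrameBundle n M)) (hp : p.1 = X) :
    tangentMap (frameModel n) (frameModel n) Ψ.toFun p =
      tangentMap (frameModel n) (frameModel n) Ψ'.toFun p := by
  subst hp
  exact h p.2

theorem tangentMap_congr_of_eventuallyEq {f g : FrameBundle n M → FrameBundle n N}
    {p : TangentBundle (frameModel n) (FrameBundle n M)} (h : f =ᶠ[𝓝 p.1] g) :
    tangentMap (frameModel n) (frameModel n) f p =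
      tangentMap (frameModel n) (frameModel n) g p :=
  TotalSpace.ext h.eq_of_nhds (heq_of_eq (by
    have h1 := h.mfderiv_eq (I := frameModel n) (I' := frameModel n)
    exact DFunLike.congr_fun h1 p.2))

theorem tangentMap_symm_tangentMap (Θ : LocalFrameIso n M N)
    (p : TangentBundle (frameModel n) (FrameBundle n M)) (hp : p.1 ∈ Θ.source) :
    tangentMap (frameModel n) (frameModel n) Θ.symm.toFun
      (tangentMap (frameModel n) (frameModel n) Θ.toFun p) = p := by
  have hc := tangentMap_comp (Φ := Θ.symm) (Ψ := Θ) hp (Θ.map_source hp) p.2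
  rw [← hc]
  have he : (Θ.symm.comp Θ).toFun =ᶠ[𝓝 p.1] id := by
    filter_upwards [Θ.open_source.mem_nhds hp] with Y hY
    exact Θ.left_inv hY
  rw [tangentMap_congr_of_eventuallyEq he, tangentMap_id]
  rfl

theorem SameJetAt.symm_of {Ψ Ψ' : LocalFrameIso n M N} {X : FrameBundle n M}
    (h : SameJetAt X Ψ Ψ') (hX : X ∈ Ψ.source) (hX' : X ∈ Ψ'.source) :
    SameJetAt (Ψ.toFun X) Ψ.symm Ψ'.symm := by
  intro w
  set q : TangentBundle (frameModel n) (FrameBundle n N) := ⟨Ψ.toFun X, w⟩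
  set p := tangentMap (frameModel n) (frameModel n) Ψ.symm.toFun q with hp
  have hpX : p.1 = X := Ψ.left_inv hX
  have h1 : tangentMap (frameModel n) (frameModel n) Ψ.toFun p = q :=
    tangentMap_symm_tangentMap Ψ.symm q (Ψ.map_source hX)
  have h2 := tangentMap_symm_tangentMap Ψ' p (hpX ▸ hX')
  rw [← h.apply p hpX, h1] at h2
  exact h2.symm

/-- Equality of `1`-jets at a frame `X` implies equality of the `1`-jets at all `X · g`. -/
theorem SameJetAt.act {Ψ Ψ' : LocalFrameIso n M N} {X : FrameBundle n M}
    (h : SameJetAt X Ψ Ψ') (hX : X ∈ Ψ.source) (hX' : X ∈ Ψ'.source) (g : Rn n ≃L[ℝ] Rn n) :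
    SameJetAt (X.act g) Ψ Ψ' := by
  have hinv : ∀ Y : FrameBundle n M, (Y.act g.symm).act g = Y := fun Y => Y.act_symm_act g
  have hXg : (X.act g).act g.symm = X := X.act_symm_act g.symm
  have dR : ∀ g : Rn n ≃L[ℝ] Rn n, MDifferentiable (frameModel n) (frameModel n)
      (fun Y : FrameBundle n M => Y.act g) := fun g =>
    (FrameBundle.contMDiff_act g).mdifferentiable (by simp)
  have dR' : ∀ g : Rn n ≃L[ℝ] Rn n, MDifferentiable (frameModel n) (frameModel n)
      (fun Y : FrameBundle n N => Y.act g) := fun g =>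
    (FrameBundle.contMDiff_act g).mdifferentiable (by simp)
  have key : ∀ (Θ : LocalFrameIso n M N) (_ : X ∈ Θ.source)
      (q : TangentBundle (frameModel n) (FrameBundle n M)), q.1 = X.act g →
      tangentMap (frameModel n) (frameModel n) Θ.toFun q =
        tangentMap (frameModel n) (frameModel n) (fun Y : FrameBundle n N => Y.act g)
          (tangentMap (frameModel n) (frameModel n) Θ.toFun
            (tangentMap (frameModel n) (frameModel n)
              (fun Y : FrameBundle n M => Y.act g.symm) q)) := by
    intro Θ hΘ q hq
    have hqX : q.1.act g.symm = X := by rw [hq, hXg]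
    have dΘ : MDifferentiableAt (frameModel n) (frameModel n) Θ.toFun (q.1.act g.symm) :=
      Θ.mdifferentiableAt (hqX ▸ hΘ)
    rw [← tangentMap_comp_at (I' := frameModel n) q dΘ (dR g.symm _),
      ← tangentMap_comp_at (I' := frameModel n) q (dR' g _)
        (dΘ.comp q.1 (dR g.symm _))]
    apply tangentMap_congr_of_eventuallyEq
    have hs : q.1 ∈ Θ.source := hq ▸ Θ.act_mem X hΘ g
    filter_upwards [Θ.open_source.mem_nhds hs] with Y hY
    show Θ.toFun Y = (Θ.toFun (Y.act g.symm)).act g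
    rw [← Θ.map_act _ (Θ.act_mem _ hY _), hinv]
  intro v
  rw [key Ψ hX ⟨X.act g, v⟩ rfl, key Ψ' hX' ⟨X.act g, v⟩ rfl]
  congr 1
  exact h.apply _ hXg

end LocalFrameIso


section bundleIso

variable {n : ℕ} {M : Type*} [TopologicalSpace M] [ChartedSpace (Rn n) M] [IsManifold (𝓡 n) ∞ M]
  {N : Type*} [TopologicalSpace N] [ChartedSpace (Rn n) N] [IsManifold (𝓡 n) ∞ N]

theorem inTangentCoordinates_comp_frame {K : Type*} {f : K → M} {g : K → N}
    (A : ∀ k, TangentSpace (𝓡 n) (f k) →L[ℝ] TangentSpace (𝓡 n) (g k)) {k₀ k : K}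
    (hk : f k ∈ (trivializationAt (Rn n) (TangentSpace (𝓡 n)) (f k₀)).baseSet)
    (e : Rn n →L[ℝ] TangentSpace (𝓡 n) (f k)) :
    ((trivializationAt (Rn n) (TangentSpace (𝓡 n)) (g k₀)).continuousLinearMapAt ℝ (g k)).comp
      ((A k).comp e) =
    (inTangentCoordinates (𝓡 n) (𝓡 n) f g A k₀ k).comp
      (((trivializationAt (Rn n) (TangentSpace (𝓡 n)) (f k₀)).continuousLinearMapAt ℝ (f k)).comp
        e) := by
  refine ContinuousLinearMap.ext fun v => ?_
  have h := (trivializationAt (Rn n) (TangentSpace (𝓡 n)) (f k₀)).symmL_continuousLinearMapAt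
    (R := ℝ) hk (e v)
  show _ = (trivializationAt (Rn n) (TangentSpace (𝓡 n)) (g k₀)).continuousLinearMapAt ℝ (g k)
    (A k ((trivializationAt (Rn n) (TangentSpace (𝓡 n)) (f k₀)).symmL ℝ (f k) _))
  erw [h]
  rfl

theorem inTangentCoordinates_symm_comp {K : Type*} {f : K → M} {g : K → N}
    (A : ∀ k, TangentSpace (𝓡 n) (f k) ≃L[ℝ] TangentSpace (𝓡 n) (g k)) {k₀ k : K}
    (hf : f k ∈ (trivializationAt (Rn n) (TangentSpace (𝓡 n)) (f k₀)).baseSet)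
    (hg : g k ∈ (trivializationAt (Rn n) (TangentSpace (𝓡 n)) (g k₀)).baseSet) :
    (inTangentCoordinates (𝓡 n) (𝓡 n) f g
      (fun k => (A k : TangentSpace (𝓡 n) (f k) →L[ℝ] TangentSpace (𝓡 n) (g k))) k₀ k).IsInvertible
    ∧ ContinuousLinearMap.inverse (inTangentCoordinates (𝓡 n) (𝓡 n) f g
      (fun k => (A k : TangentSpace (𝓡 n) (f k) →L[ℝ] TangentSpace (𝓡 n) (g k))) k₀ k) =
      inTangentCoordinates (𝓡 n) (𝓡 n) g f
      (fun k => ((A k).symm : TangentSpace (𝓡 n) (g k) →L[ℝ] TangentSpace (𝓡 n) (f k))) k₀ k := by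
  have h1 := ContinuousLinearMap.inCoordinates_eq (𝕜₁ := ℝ) (𝕜₂ := ℝ) (σ := RingHom.id ℝ)
    (ϕ := (A k : TangentSpace (𝓡 n) (f k) →L[ℝ] TangentSpace (𝓡 n) (g k))) hf hg
  have h2 := ContinuousLinearMap.inCoordinates_eq (𝕜₁ := ℝ) (𝕜₂ := ℝ) (σ := RingHom.id ℝ)
    (ϕ := ((A k).symm : TangentSpace (𝓡 n) (g k) →L[ℝ] TangentSpace (𝓡 n) (f k))) hg hf
  unfold inTangentCoordinates
  erw [h1, h2]
  set a := (trivializationAt (Rn n) (TangentSpace (𝓡 n)) (f k₀)).continuousLinearEquivAt ℝ (f k) hf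
  set b := (trivializationAt (Rn n) (TangentSpace (𝓡 n)) (g k₀)).continuousLinearEquivAt ℝ (g k) hg
  refine ⟨⟨(a.symm.trans (A k)).trans b, rfl⟩, ?_⟩
  exact ContinuousLinearMap.inverse_equiv ((a.symm.trans (A k)).trans b)

theorem contMDiffAt_symm {E' H' K : Type*} [NormedAddCommGroup E'] [NormedSpace ℝ E']
    [TopologicalSpace H'] {I' : ModelWithCorners ℝ E' H'} [TopologicalSpace K] [ChartedSpace H' K]
    {f : K → M} {g : K → N}
    (A : ∀ k, TangentSpace (𝓡 n) (f k) ≃L[ℝ] TangentSpace (𝓡 n) (g k)) {k₀ : K}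
    (hf : ContinuousAt f k₀) (hg : ContinuousAt g k₀)
    (hA : ContMDiffAt I' 𝓘(ℝ, Rn n →L[ℝ] Rn n) ∞ (inTangentCoordinates (𝓡 n) (𝓡 n) f g
      (fun k => (A k : TangentSpace (𝓡 n) (f k) →L[ℝ] TangentSpace (𝓡 n) (g k))) k₀) k₀) :
    ContMDiffAt I' 𝓘(ℝ, Rn n →L[ℝ] Rn n) ∞ (inTangentCoordinates (𝓡 n) (𝓡 n) g f
      (fun k => ((A k).symm : TangentSpace (𝓡 n) (g k) →L[ℝ] TangentSpace (𝓡 n) (f k))) k₀) k₀ := by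
  have hf' : ∀ᶠ k in 𝓝 k₀, f k ∈ (trivializationAt (Rn n) (TangentSpace (𝓡 n)) (f k₀)).baseSet :=
    hf ((trivializationAt (Rn n) (TangentSpace (𝓡 n)) (f k₀)).open_baseSet.mem_nhds
      (FiberBundle.mem_baseSet_trivializationAt' (f k₀)))
  have hg' : ∀ᶠ k in 𝓝 k₀, g k ∈ (trivializationAt (Rn n) (TangentSpace (𝓡 n)) (g k₀)).baseSet :=
    hg ((trivializationAt (Rn n) (TangentSpace (𝓡 n)) (g k₀)).open_baseSet.mem_nhds
      (FiberBundle.mem_baseSet_trivializationAt' (g k₀)))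
  have h0 := (inTangentCoordinates_symm_comp A hf'.self_of_nhds hg'.self_of_nhds).1
  have h1 := (h0.contDiffAt_map_inverse (n := ∞)).contMDiffAt.comp k₀ hA
  refine h1.congr_of_eventuallyEq ?_
  filter_upwards [hf', hg'] with k hk hk'
  exact (inTangentCoordinates_symm_comp A hk hk').2.symm

/-- The local isomorphism `X ↦ A (π X) ∘ X` of frame bundles over a local diffeomorphism `ψ`,
where `A x : T_xM ≃ T_{ψ x}N` depends smoothly on `x`. -/
def bundleIso (ψ : LocalDiffeo n M N)
    (A : ∀ x : M, TangentSpace (𝓡 n) x ≃L[ℝ] TangentSpace (𝓡 n) (ψ.toFun x))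
    (hA : ∀ x₀ ∈ ψ.source, ContMDiffAt (𝓡 n) 𝓘(ℝ, Rn n →L[ℝ] Rn n) ∞
      (inTangentCoordinates (𝓡 n) (𝓡 n) id ψ.toFun
        (fun x => (A x : TangentSpace (𝓡 n) x →L[ℝ] TangentSpace (𝓡 n) (ψ.toFun x))) x₀) x₀) :
    LocalFrameIso n M N where
  toFun X := FrameBundle.mk (ψ.toFun X.proj) (X.toEquiv.trans (A X.proj))
  invFun Y := FrameBundle.mk (ψ.invFun Y.proj) (ContinuousLinearEquiv.trans (M₂ := Rn n) Y.toEquiv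
    (A (ψ.invFun Y.proj)).symm)
  source := {X | X.proj ∈ ψ.source}
  target := {Y | Y.proj ∈ ψ.target}
  map_source' X hX := ψ.map_source hX
  map_target' Y hY := ψ.map_target hY
  left_inv' X hX := by
    rw [FrameBundle.proj_mk, FrameBundle.toEquiv_mk]
    have key : ∀ x', x' = X.proj → FrameBundle.mk x' (ContinuousLinearEquiv.trans (M₂ := Rn n)
        (X.toEquiv.trans (A X.proj)) (A x').symm) = X := by
      rintro _ rfl
      conv_rhs => rw [← FrameBundle.mk_toEquiv X]
      congr 1
      exact ContinuousLinearEquiv.ext (funext fun v => (A X.proj).symm_apply_apply _)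
    exact key _ (ψ.left_inv hX)
  right_inv' Y hY := by
    rw [FrameBundle.proj_mk, FrameBundle.toEquiv_mk]
    have key : ∀ y' (B : TangentSpace (𝓡 n) (ψ.invFun Y.proj) ≃L[ℝ] Rn n),
        y' = Y.proj → FrameBundle.mk y' (ContinuousLinearEquiv.trans
        (ContinuousLinearEquiv.trans (M₂ := Rn n) Y.toEquiv B.symm) B) = Y := by
      rintro _ B rfl
      conv_rhs => rw [← FrameBundle.mk_toEquiv Y]
      congr 1
      exact ContinuousLinearEquiv.ext (funext fun v => B.apply_symm_apply _)
    exact key _ (A (ψ.invFun Y.proj)) (ψ.right_inv hY)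
  open_source := ψ.open_source.preimage FrameBundle.contMDiff_proj.continuous
  open_target := ψ.open_target.preimage FrameBundle.contMDiff_proj.continuous
  contMDiffOn_toFun X₀ hX₀ := by
    refine ContMDiffAt.contMDiffWithinAt ?_
    have hX := FrameBundle.contMDiffAt_iff.1
      (contMDiffAt_id (I := frameModel n) (x := X₀) (n := ∞))
    have hψ := ψ.contMDiffOn.contMDiffAt (ψ.open_source.mem_nhds hX₀)
    refine FrameBundle.contMDiffAt_iff.2 ⟨hψ.comp X₀ hX.1, ?_⟩
    refine (((hA _ hX₀).comp X₀ hX.1).clm_comp hX.2).congr_of_eventuallyEq ?_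
    have hb := (FrameBundle.contMDiff_proj.continuous.continuousAt (x := X₀))
      ((trivializationAt (Rn n) (TangentSpace (𝓡 n)) X₀.proj).open_baseSet.mem_nhds
        (FiberBundle.mem_baseSet_trivializationAt' X₀.proj))
    filter_upwards [hb] with X hX
    simp only [FrameBundle.toEquiv_mk, FrameBundle.proj_mk]
    exact inTangentCoordinates_comp_frame (f := id) (g := ψ.toFun) (fun x => (A x :
      TangentSpace (𝓡 n) x →L[ℝ] TangentSpace (𝓡 n) (ψ.toFun x))) (k₀ := X₀.proj)
      (k := X.proj) hX (X.toEquiv : Rn n →L[ℝ] TangentSpace (𝓡 n) X.proj)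
  contMDiffOn_invFun Y₀ hY₀ := by
    refine ContMDiffAt.contMDiffWithinAt ?_
    have hY := FrameBundle.contMDiffAt_iff.1
      (contMDiffAt_id (I := frameModel n) (x := Y₀) (n := ∞))
    have hψ := ψ.symm.contMDiffOn.contMDiffAt (ψ.open_target.mem_nhds hY₀)
    have hs : ψ.invFun Y₀.proj ∈ ψ.source := ψ.map_target hY₀
    have hψ' := ψ.contMDiffOn.contMDiffAt (ψ.open_source.mem_nhds hs)
    have hB := contMDiffAt_symm (f := id) (g := ψ.toFun) A continuousAt_id hψ'.continuousAt
      (hA _ hs)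
    have hc := hψ.comp Y₀ hY.1
    refine FrameBundle.contMDiffAt_iff.2 ⟨hc, ?_⟩
    refine ((hB.comp Y₀ hc).clm_comp hY.2).congr_of_eventuallyEq ?_
    have hb := (FrameBundle.contMDiff_proj.continuous.continuousAt (x := Y₀))
      (Filter.inter_mem (ψ.open_target.mem_nhds hY₀)
      ((trivializationAt (Rn n) (TangentSpace (𝓡 n)) Y₀.proj).open_baseSet.mem_nhds
        (FiberBundle.mem_baseSet_trivializationAt' Y₀.proj)))
    filter_upwards [hb] with Y hY
    simp only [FrameBundle.toEquiv_mk, FrameBundle.proj_mk]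
    have h1 := inTangentCoordinates_comp_frame (f := id) (g := ψ.invFun)
      (fun y => ((A (ψ.invFun y)).symm :
        TangentSpace (𝓡 n) (ψ.toFun (ψ.invFun y)) →L[ℝ] TangentSpace (𝓡 n) (ψ.invFun y))) (k₀ := Y₀.proj)
      (k := Y.proj) hY.2 (Y.toEquiv : Rn n →L[ℝ] TangentSpace (𝓡 n) Y.proj)
    have h2 : ∀ (y₀ y : N) (φ : Rn n →L[ℝ] Rn n), y₀ = Y₀.proj → y = Y.proj →
        ContinuousLinearMap.inCoordinates (Rn n) (TangentSpace (𝓡 n)) (Rn n) (TangentSpace (𝓡 n))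
          y₀ y (ψ.invFun Y₀.proj) (ψ.invFun Y.proj) φ =
        ContinuousLinearMap.inCoordinates (Rn n) (TangentSpace (𝓡 n)) (Rn n) (TangentSpace (𝓡 n))
          Y₀.proj Y.proj (ψ.invFun Y₀.proj) (ψ.invFun Y.proj) φ := by
      rintro _ _ φ rfl rfl
      rfl
    have h3 := h2 (ψ.toFun (ψ.invFun Y₀.proj)) (ψ.toFun (ψ.invFun Y.proj))
      ((A (ψ.invFun Y.proj)).symm : TangentSpace (𝓡 n) (ψ.toFun (ψ.invFun Y.proj)) →L[ℝ]
        TangentSpace (𝓡 n) (ψ.invFun Y.proj)) (ψ.right_inv hY₀) (ψ.right_inv hY.1)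
    refine Eq.trans h1 ?_
    congr 1
    exact h3.symm
  act_mem X hX g := hX
  map_act X hX g := by
    simp only [FrameBundle.act, FrameBundle.proj_mk, FrameBundle.toEquiv_mk]
    rfl

end bundleIso


/-- The `1`-jet of `f` at `x` is `j¹_{x,y} f = A`, i.e. `f x = y` and `T_x f = A`. -/
def IsOneJet {n : ℕ} {M N : Type*} [TopologicalSpace M] [ChartedSpace (Rn n) M]
    [TopologicalSpace N] [ChartedSpace (Rn n) N] (f : M → N) (x : M) (y : N)
    (A : TangentSpace (𝓡 n) x ≃L[ℝ] TangentSpace (𝓡 n) y) : Prop :=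
  ∀ v : TangentSpace (𝓡 n) x, tangentMap (𝓡 n) (𝓡 n) f ⟨x, v⟩ = ⟨y, A v⟩

/-- The translation `τ_v` of `ℝⁿ`. -/
def translation {n : ℕ} (v : Rn n) : LocalDiffeo n (Rn n) (Rn n) where
  toPartialEquiv := (Equiv.addRight v).toPartialEquiv
  open_source := isOpen_univ
  open_target := isOpen_univ
  contMDiffOn_toFun := (contDiff_id.add contDiff_const).contMDiff.contMDiffOn
  contMDiffOn_invFun := (contDiff_id.add contDiff_const).contMDiff.contMDiffOn

section lifts

variable {n : ℕ} {M : Type*} [TopologicalSpace M] [ChartedSpace (Rn n) M] [IsManifold (𝓡 n) ∞ M]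
  {N : Type*} [TopologicalSpace N] [ChartedSpace (Rn n) N] [IsManifold (𝓡 n) ∞ N]

/-- The tangent map of a local diffeomorphism at the points of its domain, as a linear
isomorphism (and an irrelevant value elsewhere). -/
def LocalDiffeo.derivEquiv (ψ : LocalDiffeo n M N) (x : M) :
    TangentSpace (𝓡 n) x ≃L[ℝ] TangentSpace (𝓡 n) (ψ.toFun x) :=
  open Classical in
  if hx : x ∈ ψ.source then
    (ψ.isLocalDiffeomorphAt (𝓡 n) (𝓡 n) ∞ hx).mfderivToContinuousLinearEquiv (by simp)
  else ContinuousLinearEquiv.refl ℝ (Rn n)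

theorem LocalDiffeo.derivEquiv_coe (ψ : LocalDiffeo n M N) {x : M} (hx : x ∈ ψ.source) :
    (LocalDiffeo.derivEquiv ψ x : TangentSpace (𝓡 n) x →L[ℝ] TangentSpace (𝓡 n) (ψ.toFun x)) =
      mfderiv (𝓡 n) (𝓡 n) ψ.toFun x := by
  have h : LocalDiffeo.derivEquiv ψ x =
      (ψ.isLocalDiffeomorphAt (𝓡 n) (𝓡 n) ∞ hx).mfderivToContinuousLinearEquiv (by simp) :=
    dif_pos hx
  rw [h]
  exact IsLocalDiffeomorphAt.mfderivToContinuousLinearEquiv_coe _ _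

/-- The map `Fψ : FU → FV`, `Fψ(j¹φ) = j¹(ψ ∘ φ)`, i.e. `X ↦ Tψ ∘ X`, induced by a local
diffeomorphism `ψ : U → V`. -/
def frameLift (ψ : LocalDiffeo n M N) : LocalFrameIso n M N :=
  bundleIso ψ (LocalDiffeo.derivEquiv ψ) (by
    intro x₀ hx₀
    have h := (ψ.contMDiffOn.contMDiffAt (ψ.open_source.mem_nhds hx₀)).mfderiv_const
      (m := ∞) (by simp)
    refine h.congr_of_eventuallyEq ?_
    filter_upwards [ψ.open_source.mem_nhds hx₀] with x hx
    simp only [inTangentCoordinates, LocalDiffeo.derivEquiv_coe ψ hx])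

/-- A chart of the atlas at `x`. -/
def chartDiffeo (x : M) : LocalDiffeo n M (Rn n) where
  toPartialEquiv := (chartAt (Rn n) x).toPartialEquiv
  open_source := (chartAt (Rn n) x).open_source
  open_target := (chartAt (Rn n) x).open_target
  contMDiffOn_toFun := contMDiffOn_chart
  contMDiffOn_invFun := contMDiffOn_chart_symm

/-- A linear isomorphism of `ℝⁿ`. -/
def linearDiffeo (B : Rn n ≃L[ℝ] Rn n) : LocalDiffeo n (Rn n) (Rn n) where
  toPartialEquiv := B.toEquiv.toPartialEquiv
  open_source := isOpen_univ
  open_target := isOpen_univ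
  contMDiffOn_toFun := B.contDiff.contMDiff.contMDiffOn
  contMDiffOn_invFun := B.symm.contDiff.contMDiff.contMDiffOn

theorem exists_isOneJet (x : M) (y : N)
    (A : TangentSpace (𝓡 n) x ≃L[ℝ] TangentSpace (𝓡 n) y) :
    ∃ ψ : LocalDiffeo n M N, x ∈ ψ.source ∧ IsOneJet ψ.toFun x y A := by
  let φ : LocalDiffeo n M (Rn n) := (chartDiffeo x).trans (translation (-(chartAt (Rn n) x x)))
  let η : LocalDiffeo n N (Rn n) := (chartDiffeo y).trans (translation (-(chartAt (Rn n) y y)))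
  have hφx : x ∈ φ.source := ⟨mem_chart_source _ x, trivial⟩
  have hηy : y ∈ η.source := ⟨mem_chart_source _ y, trivial⟩
  have hφ0 : φ.toFun x = 0 := add_neg_cancel (chartAt (Rn n) x x)
  have hη0 : η.toFun y = 0 := add_neg_cancel (chartAt (Rn n) y y)
  let B : Rn n ≃L[ℝ] Rn n := ((φ.derivEquiv x).symm.trans A).trans (η.derivEquiv y)
  have h0 : (0 : Rn n) ∈ η.target := hη0 ▸ η.map_source hηy
  have hB0 : B (φ.toFun x) = 0 := by rw [hφ0, map_zero]
  have hx : x ∈ ((φ.trans (linearDiffeo B)).trans η.symm).source := by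
    refine ⟨⟨hφx, trivial⟩, ?_⟩
    show B (φ.toFun x) ∈ η.target
    rw [hB0]; exact h0
  refine ⟨(φ.trans (linearDiffeo B)).trans η.symm, hx, fun v => ?_⟩
  have dφ : MDifferentiableAt (𝓡 n) (𝓡 n) φ.toFun x := φ.mdifferentiableAt (by simp) hφx
  have dB : MDifferentiableAt (𝓡 n) (𝓡 n) (B : Rn n → Rn n) (φ.toFun x) :=
    B.differentiableAt.mdifferentiableAt
  have dη : MDifferentiableAt (𝓡 n) (𝓡 n) η.invFun (B (φ.toFun x)) :=
    η.symm.mdifferentiableAt (by simp) hx.2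
  have dη' : MDifferentiableAt (𝓡 n) (𝓡 n) η.toFun y := η.mdifferentiableAt (by simp) hηy
  have dη'' : MDifferentiableAt (𝓡 n) (𝓡 n) η.invFun (η.toFun y) :=
    η.symm.mdifferentiableAt (by simp) (η.map_source hηy)
  have e1 : tangentMap (𝓡 n) (𝓡 n) ((φ.trans (linearDiffeo B)).trans η.symm).toFun ⟨x, v⟩ =
      tangentMap (𝓡 n) (𝓡 n) η.invFun (tangentMap (𝓡 n) (𝓡 n) (B : Rn n → Rn n)
        (tangentMap (𝓡 n) (𝓡 n) φ.toFun ⟨x, v⟩)) := by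
    rw [← tangentMap_comp_at (I' := 𝓡 n) (tangentMap (𝓡 n) (𝓡 n) φ.toFun ⟨x, v⟩) dη dB,
      ← tangentMap_comp_at (I' := 𝓡 n) (⟨x, v⟩ : TangentBundle (𝓡 n) M) (dη.comp _ dB) dφ]
    rfl
  have e2 : tangentMap (𝓡 n) (𝓡 n) (B : Rn n → Rn n) (tangentMap (𝓡 n) (𝓡 n) φ.toFun ⟨x, v⟩) =
      tangentMap (𝓡 n) (𝓡 n) η.toFun ⟨y, A v⟩ := by
    have k1 : mfderiv (𝓡 n) (𝓡 n) φ.toFun x v = φ.derivEquiv x v :=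
      (DFunLike.congr_fun (φ.derivEquiv_coe hφx) v).symm
    have k2 : mfderiv (𝓡 n) (𝓡 n) η.toFun y (A v) = η.derivEquiv y (A v) :=
      (DFunLike.congr_fun (η.derivEquiv_coe hηy) (A v)).symm
    refine TotalSpace.ext (hB0.trans hη0.symm) (heq_of_eq ?_)
    show mfderiv (𝓡 n) (𝓡 n) (B : Rn n → Rn n) (φ.toFun x) (mfderiv (𝓡 n) (𝓡 n) φ.toFun x v) =
      mfderiv (𝓡 n) (𝓡 n) η.toFun y (A v)
    rw [k1, k2, mfderiv_eq_fderiv]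
    erw [B.fderiv]
    show η.derivEquiv y (A ((φ.derivEquiv x).symm (φ.derivEquiv x v))) = η.derivEquiv y (A v)
    rw [ContinuousLinearEquiv.symm_apply_apply]
  rw [e1, e2, ← tangentMap_comp_at (I' := 𝓡 n) (⟨y, A v⟩ : TangentBundle (𝓡 n) N) dη'' dη']
  have he : η.invFun ∘ η.toFun =ᶠ[𝓝 y] id := by
    filter_upwards [η.open_source.mem_nhds hηy] with z hz
    exact η.left_inv hz
  refine TotalSpace.ext he.eq_of_nhds (heq_of_eq ?_)
  have h1 := (he.mfderiv_eq (I := 𝓡 n) (I' := 𝓡 n)).trans mfderiv_id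
  exact DFunLike.congr_fun h1 (A v)

/-- A local diffeomorphism `ψ` with `j¹_{x,y} ψ = A`. -/
def jetRep (x : M) (y : N) (A : TangentSpace (𝓡 n) x ≃L[ℝ] TangentSpace (𝓡 n) y) :
    LocalDiffeo n M N :=
  Classical.choose (exists_isOneJet x y A)

theorem jetRep_mem (x : M) (y : N) (A : TangentSpace (𝓡 n) x ≃L[ℝ] TangentSpace (𝓡 n) y) :
    x ∈ (jetRep x y A).source :=
  (Classical.choose_spec (exists_isOneJet x y A)).1

theorem jetRep_isOneJet (x : M) (y : N)
    (A : TangentSpace (𝓡 n) x ≃L[ℝ] TangentSpace (𝓡 n) y) :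
    IsOneJet (jetRep x y A).toFun x y A :=
  (Classical.choose_spec (exists_isOneJet x y A)).2

theorem jetRep_apply (x : M) (y : N) (A : TangentSpace (𝓡 n) x ≃L[ℝ] TangentSpace (𝓡 n) y) :
    (jetRep x y A).toFun x = y :=
  congrArg TotalSpace.proj (jetRep_isOneJet x y A 0)

end lifts

section jets

variable (n : ℕ) (M : Type*) [TopologicalSpace M] [ChartedSpace (Rn n) M] [IsManifold (𝓡 n) ∞ M]

/-- The frame `e₁ = j¹_{0,0} Id` of `ℝⁿ` at `0`. -/
def stdFrame : FrameBundle n (Rn n) := FrameBundle.mk 0 (ContinuousLinearEquiv.refl ℝ (Rn n))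

/-- Equality of the `1`-jets at `e₁` of local isomorphisms `Fℝⁿ → FM` over `0 ↦ x`. -/
def nonholonomicFrameSetoid (x : M) :
    Setoid {Ψ : LocalFrameIso n (Rn n) M // Ψ.IsOver 0 x} where
  r Ψ Ψ' := LocalFrameIso.SameJetAt (stdFrame n) Ψ.1 Ψ'.1
  iseqv := ⟨fun _ _ => rfl, fun h v => (h v).symm, fun h h' v => (h v).trans (h' v)⟩

/-- The fibre over `x` of the non-holonomic frame bundle of second order `F̄²M`: the `1`-jets
`j¹_{e₁,Ψ(e₁)} Ψ` of the local isomorphisms `Ψ : Fℝⁿ → FM` of principal bundles with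
`ψ(0) = x`. -/
def NonholonomicFrame (x : M) : Type _ := Quotient (nonholonomicFrameSetoid n M x)

/-- Equality of the classes modulo `Gl(n, ℝ)` of the `1`-jets of local automorphisms over `x ↦ y`:
equality of the `1`-jets at every frame over `x` (equivalently, at one of them). -/
def frameJetSetoid (x y : M) : Setoid {Ψ : LocalFrameIso n M M // Ψ.IsOver x y} where
  r Ψ Ψ' := ∀ X : FrameBundle n M, X.proj = x → LocalFrameIso.SameJetAt X Ψ.1 Ψ'.1
  iseqv := ⟨fun _ _ _ _ => rfl, fun h X hX v => (h X hX v).symm,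
    fun h h' X hX v => (h X hX v).trans (h' X hX v)⟩

/-- The elements `j¹_{x,y} Ψ` from `x` to `y` of the second-order non-holonomic groupoid
`J̃¹(FM)`, the quotient by `Gl(n, ℝ)` of the groupoid of `1`-jets of local automorphisms of `FM`:
the class of `Ψ` contains the `1`-jets of `Ψ` at all frames over `x`. -/
def FrameJet (x y : M) : Type _ := Quotient (frameJetSetoid n M x y)

variable {n M}

/-- `a = j¹_{e₁} Ψ`. -/
def NonholonomicFrame.IsJetOf {x : M} (a : NonholonomicFrame n M x)
    (Ψ : LocalFrameIso n (Rn n) M) : Prop :=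
  ∃ h : Ψ.IsOver 0 x, a = Quotient.mk (nonholonomicFrameSetoid n M x) ⟨Ψ, h⟩

/-- `a = j¹_{x,y} Ψ`. -/
def FrameJet.IsJetOf {x y : M} (a : FrameJet n M x y) (Ψ : LocalFrameIso n M M) : Prop :=
  ∃ h : Ψ.IsOver x y, a = Quotient.mk (frameJetSetoid n M x y) ⟨Ψ, h⟩

/-- The composition `j¹_{y,z} Φ · j¹_{x,y} Ψ = j¹_{x,z} (Φ ∘ Ψ)` of the groupoid `J̃¹(FM)`. -/
def FrameJet.comp {x y z : M} : FrameJet n M y z → FrameJet n M x y → FrameJet n M x z :=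
  Quotient.map₂ (sa := frameJetSetoid n M y z) (sb := frameJetSetoid n M x y)
    (sc := frameJetSetoid n M x z)
    (fun Φ Ψ => ⟨Φ.1.comp Ψ.1, Φ.2.comp Ψ.2⟩) (by
      intro Φ Φ' hΦ Ψ Ψ' hΨ X hX
      exact (hΨ X hX).comp (hΦ _ (Ψ.2 X hX).2) (Ψ.2 X hX).1 (Ψ'.2 X hX).1
        (Φ.2 _ (Ψ.2 X hX).2).1 (Φ'.2 _ (Ψ.2 X hX).2).1)

/-- The class `b · a⁻¹ = j¹_{x,y} (Φ ∘ Ψ⁻¹)` in `J̃¹(FM)`, for non-holonomic frames of second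
order `a = j¹_{e₁} Ψ` at `x` and `b = j¹_{e₁} Φ` at `y`. -/
def NonholonomicFrame.div {x y : M} :
    NonholonomicFrame n M y → NonholonomicFrame n M x → FrameJet n M x y :=
  Quotient.map₂ (sa := nonholonomicFrameSetoid n M y) (sb := nonholonomicFrameSetoid n M x)
    (sc := frameJetSetoid n M x y)
    (fun Φ Ψ => ⟨Φ.1.comp Ψ.1.symm, Φ.2.comp Ψ.2.symm⟩) (by
      intro Φ Φ' hΦ Ψ Ψ' hΨ X hX
      have hΨ0 := Ψ.2 (stdFrame n) rfl
      have hΨ0' := Ψ'.2 (stdFrame n) rfl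
      have hinv : Ψ.1.symm.toFun (Ψ.1.toFun (stdFrame n)) = stdFrame n := Ψ.1.left_inv hΨ0.1
      have hs : LocalFrameIso.SameJetAt (Ψ.1.toFun (stdFrame n)) Ψ.1.symm Ψ'.1.symm :=
        LocalFrameIso.SameJetAt.symm_of hΨ hΨ0.1 hΨ0'.1
      obtain ⟨g, rfl⟩ := FrameBundle.exists_act_eq (hΨ0.2.trans hX.symm)
      have h1 : Ψ.1.toFun (stdFrame n) ∈ (Φ.1.comp Ψ.1.symm).source :=
        ((Φ.2.comp Ψ.2.symm) _ hΨ0.2).1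
      have h1' : Ψ.1.toFun (stdFrame n) ∈ (Φ'.1.comp Ψ'.1.symm).source :=
        ((Φ'.2.comp Ψ'.2.symm) _ hΨ0.2).1
      refine LocalFrameIso.SameJetAt.act ?_ h1 h1' g
      have hs' : Ψ.1.symm.toFun (Ψ.1.toFun (stdFrame n)) =
        Ψ'.1.symm.toFun (Ψ.1.toFun (stdFrame n)) := hs.map_eq
      refine hs.comp ?_ h1.1 h1'.1 h1.2 ?_
      · rw [hinv]
        exact hΦ
      · rw [hs']
        exact h1'.2)

end jets

/-- Smooth sections `P` of the frame bundle `FM` (ordinary parallelisms of `M`), the frame `P(x)`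
being a linear isomorphism `ℝⁿ ≃ T_xM`. -/
structure FrameSection (n : ℕ) (M : Type*) [TopologicalSpace M] [ChartedSpace (Rn n) M]
    [IsManifold (𝓡 n) ∞ M] where
  toFun : ∀ x : M, Rn n ≃L[ℝ] TangentSpace (𝓡 n) x
  smooth : ContMDiff (𝓡 n) (frameModel n) ∞ (fun x => FrameBundle.mk x (toFun x))

/-- Smooth sections `𝒫` of `(α, β)` in the `1`-jets groupoid `Π¹(M,M)`, whose elements from `x` to
`y` are the linear isomorphisms `T_xM ≃ T_yM`; smoothness is that of the matrix of `𝒫(x,y)` in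
charts around `x₀` and `y₀`, i.e. in the coordinates `(x^i, y^j, y^j_i)`. -/
structure OneJetSection (n : ℕ) (M : Type*) [TopologicalSpace M] [ChartedSpace (Rn n) M]
    [IsManifold (𝓡 n) ∞ M] where
  toFun : ∀ x y : M, TangentSpace (𝓡 n) x ≃L[ℝ] TangentSpace (𝓡 n) y
  smooth : ∀ p₀ : M × M, ContMDiffAt ((𝓡 n).prod (𝓡 n)) 𝓘(ℝ, Rn n →L[ℝ] Rn n) ∞
    (inTangentCoordinates (𝓡 n) (𝓡 n) Prod.fst Prod.snd (fun p : M × M =>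
      (toFun p.1 p.2 : TangentSpace (𝓡 n) p.1 →L[ℝ] TangentSpace (𝓡 n) p.2)) p₀) p₀

section sections

variable {n : ℕ} {M : Type*} [TopologicalSpace M] [ChartedSpace (Rn n) M] [IsManifold (𝓡 n) ∞ M]

namespace FrameSection

/-- The local isomorphism `X ↦ P(ψ(v)) ∘ X` (`X` a frame of `ℝⁿ` at `v`, translated to `0`) from
`Fℝⁿ` to `FM` over `ψ`. -/
def lift (P : FrameSection n M) (ψ : LocalDiffeo n (Rn n) M) : LocalFrameIso n (Rn n) M :=
  bundleIso ψ (fun v => P.toFun (ψ.toFun v)) (by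
    intro v₀ hv₀
    have hψ := ψ.contMDiffOn.contMDiffAt (ψ.open_source.mem_nhds hv₀)
    have h := (FrameBundle.contMDiffAt_iff.1 (P.smooth (ψ.toFun v₀))).2.comp v₀ hψ
    refine h.congr_of_eventuallyEq (Filter.Eventually.of_forall fun v => ?_)
    simp only [inTangentCoordinates, ContinuousLinearMap.inCoordinates, Function.comp,
      FrameBundle.toEquiv_mk, FrameBundle.proj_mk]
    erw [TangentBundle.symmL_model_space]
    rfl)

theorem lift_isOver (P : FrameSection n M) {ψ : LocalDiffeo n (Rn n) M} {x : M}
    (h0 : (0 : Rn n) ∈ ψ.source) (hx : ψ.toFun 0 = x) : (P.lift ψ).IsOver 0 x := by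
  intro X hX
  refine ⟨?_, ?_⟩
  · show X.proj ∈ ψ.source
    rw [hX]; exact h0
  · show ψ.toFun X.proj = x
    rw [hX]; exact hx

/-- The second-order non-holonomic prolongation `P¹(Q)`, the section of `F̄²M` given by
`P¹(Q)(x) = j¹_{e₁} (X ↦ P(ψ_x(v)) ∘ X)` where `Q(x) = j¹_{0,x} ψ_x`. -/
def prolongation (P Q : FrameSection n M) (x : M) : NonholonomicFrame n M x :=
  Quotient.mk (nonholonomicFrameSetoid n M x) ⟨P.lift (jetRep (0 : Rn n) x (Q.toFun x)),
    P.lift_isOver (jetRep_mem _ _ _) (jetRep_apply _ _ _)⟩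

/-- `Q` is integrable: near each point there is a local chart `ψ` with
`Q(x) = j¹_{0,x} (ψ⁻¹ ∘ τ_{ψ(x)})` for all `x` in its domain. -/
def IsIntegrable (Q : FrameSection n M) : Prop :=
  ∀ z : M, ∃ ψ : LocalDiffeo n M (Rn n), z ∈ ψ.source ∧ ∀ x ∈ ψ.source,
    IsOneJet ((translation (ψ.toFun x)).trans ψ.symm).toFun (0 : Rn n) x (Q.toFun x)

end FrameSection

namespace OneJetSection

/-- The local automorphism `X ↦ 𝒫(v, ψ(v)) ∘ X` (`X` a frame at `v`) of `FM` over `ψ`. -/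
def lift (cP : OneJetSection n M) (ψ : LocalDiffeo n M M) : LocalFrameIso n M M :=
  bundleIso ψ (fun x => cP.toFun x (ψ.toFun x)) (by
    intro x₀ hx₀
    have hψ := ψ.contMDiffOn.contMDiffAt (ψ.open_source.mem_nhds hx₀)
    exact (cP.smooth (x₀, ψ.toFun x₀)).comp x₀ (contMDiffAt_id.prodMk hψ))

theorem lift_isOver (cP : OneJetSection n M) {ψ : LocalDiffeo n M M} {x y : M}
    (h0 : x ∈ ψ.source) (hx : ψ.toFun x = y) : (cP.lift ψ).IsOver x y := by
  intro X hX
  refine ⟨?_, ?_⟩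
  · show X.proj ∈ ψ.source
    rw [hX]; exact h0
  · show ψ.toFun X.proj = y
    rw [hX]; exact hx

/-- The second-order non-holonomic prolongation `𝒫¹(𝒬)`, the section of `(ᾱ, β̄)` in `J̃¹(FM)`
given by `𝒫¹(𝒬)(x,y) = j¹_{x,y} (X ↦ 𝒫(v, ψ_{xy}(v)) ∘ X)` where `𝒬(x,y) = j¹_{x,y} ψ_{xy}`. -/
def prolongation (cP cQ : OneJetSection n M) (x y : M) : FrameJet n M x y :=
  Quotient.mk (frameJetSetoid n M x y) ⟨cP.lift (jetRep x y (cQ.toFun x y)),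
    cP.lift_isOver (jetRep_mem _ _ _) (jetRep_apply _ _ _)⟩

/-- `𝒫` (which is smooth) is a morphism of Lie groupoids over the identity map from the pair
groupoid `M × M` to `Π¹(M,M)`. -/
def IsMorphism (cP : OneJetSection n M) : Prop :=
  ∀ x y z : M, (cP.toFun x y).trans (cP.toFun y z) = cP.toFun x z

/-- `𝒬` is integrable: it is a parallelism, i.e. a morphism of groupoids, and near all points
`x₀` and `y₀` there are local charts `ψ` and `φ` with
`𝒬(x,y) = j¹_{x,y} (φ⁻¹ ∘ τ_{φ(y)-ψ(x)} ∘ ψ)` for all `x` and `y` in their domains. -/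
def IsIntegrable (cQ : OneJetSection n M) : Prop :=
  cQ.IsMorphism ∧ ∀ x₀ y₀ : M, ∃ ψ φ : LocalDiffeo n M (Rn n), x₀ ∈ ψ.source ∧ y₀ ∈ φ.source ∧
    ∀ x ∈ ψ.source, ∀ y ∈ φ.source,
      IsOneJet ((ψ.trans (translation (φ.toFun y - ψ.toFun x))).trans φ.symm).toFun x y
        (cQ.toFun x y)

end OneJetSection

/-- The map `𝒢̄` from sections of `F̄²M` to sections of `(ᾱ, β̄)` in `J̃¹(FM)`:
`𝒢̄P̄ (x,y) = P̄(y) · P̄(x)⁻¹`. -/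
def gaugeMap (Pbar : ∀ x : M, NonholonomicFrame n M x) (x y : M) : FrameJet n M x y :=
  (Pbar y).div (Pbar x)

/-- A section `P̄` of `F̄²M` is integrable: near each point there is a local chart `ψ` with
`P̄(x) = j¹_{e₁} F(ψ⁻¹ ∘ τ_{ψ(x)})` for all `x` in its domain. -/
def IsIntegrableFrame (Pbar : ∀ x : M, NonholonomicFrame n M x) : Prop :=
  ∀ z : M, ∃ ψ : LocalDiffeo n M (Rn n), z ∈ ψ.source ∧ ∀ x ∈ ψ.source,
    (Pbar x).IsJetOf (frameLift ((translation (ψ.toFun x)).trans ψ.symm))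

/-- A section `𝒫̄` of `(ᾱ, β̄)` in `J̃¹(FM)` is integrable: it is a parallelism, i.e. a morphism of
groupoids, and near all points `x₀` and `y₀` there are local charts `ψ` and `φ` with
`𝒫̄(x,y) = j¹_{x,y} F(φ⁻¹ ∘ τ_{φ(y)-ψ(x)} ∘ ψ)` for all `x` and `y` in their domains. -/
def IsIntegrableJet (Pbar : ∀ x y : M, FrameJet n M x y) : Prop :=
  (∀ x y z : M, (Pbar y z).comp (Pbar x y) = Pbar x z) ∧
  ∀ x₀ y₀ : M, ∃ ψ φ : LocalDiffeo n M (Rn n), x₀ ∈ ψ.source ∧ y₀ ∈ φ.source ∧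
    ∀ x ∈ ψ.source, ∀ y ∈ φ.source, (Pbar x y).IsJetOf
      (frameLift ((ψ.trans (translation (φ.toFun y - ψ.toFun x))).trans φ.symm))

end sections

end

/-!
A section `P` of `FM` induces the parallelism `(x, y) ↦ P(y) ∘ P(x)⁻¹`, and everything rests on two
facts about jets.

* The `1`-jet at `X` of a map `Y ↦ F(Y, f(π Y))`, with `F` smooth, depends only on the `1`-jet of
  `f` at `π X` (`LocalFrameIso.sameJetAt_of_factor`). Both prolongations have this form.
* A jet in `J̃¹(FM)` determines the value of a representative on the frames over `x` and the
  `1`-jet of the map it induces on the base (`OneJetSection.of_prolongation_eq`); the latter is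
  read off along a global smooth section of `FM`, using that `π ∘ Ψ ∘ σ` is the induced map.

A representative of `𝒢̄P¹(Q)(x,y)` is `X ↦ P(f v) ∘ P(v)⁻¹ ∘ X`, `f` being any local diffeomorphism
with `1`-jet `Q(y) ∘ Q(x)⁻¹` at `x`. Hence `𝒢̄P¹(Q) = 𝒫¹(𝒬)` holds exactly when `P` induces `𝒫` and
`Q` induces `𝒬` (`gaugeMap_prolongation_eq`, `induces_of_gaugeMap_prolongation_eq`). Induced
parallelisms are morphisms, and a morphism `𝒫` is induced by `x ↦ 𝒫(x₀, x) ∘ e` for any frame `e`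
at any point `x₀` (`OneJetSection.IsMorphism.induces_spread`), which gives the first part.

If `𝒬` is integrable, with charts `ψ` around `x₀` and `φ` around `z`, then near `z` the section
`Q(y) = 𝒬(x₀, y) ∘ e` is `T(φ⁻¹) ∘ Tψ(x₀) ∘ e`, and absorbing the constant `Tψ(x₀) ∘ e` into `φ`
gives a chart that shows that `Q` is integrable (`OneJetSection.IsIntegrable.spread`): this is the
third part. If `𝒫¹(𝒬)` is an integrable section, comparison of values and of base jets shows that
`𝒫 = 𝒬` and that `𝒬` is integrable (`OneJetSection.of_isIntegrableJet`). So a single integrable `Q`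
induces both, and `P¹(Q)` with `P = Q` is an integrable section
(`FrameSection.IsIntegrable.isIntegrableFrame`), which is the second part.
-/

/-! ### First-order jets of local diffeomorphisms -/

section oneJets

variable {n : ℕ} {M : Type*} [TopologicalSpace M] [ChartedSpace (Rn n) M]
  {N : Type*} [TopologicalSpace N] [ChartedSpace (Rn n) N]
  {L : Type*} [TopologicalSpace L] [ChartedSpace (Rn n) L]

theorem IsOneJet.apply_eq {f : M → N} {x : M} {y : N}
    {A : TangentSpace (𝓡 n) x ≃L[ℝ] TangentSpace (𝓡 n) y} (h : IsOneJet f x y A) : f x = y :=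
  congrArg TotalSpace.proj (h 0)

theorem IsOneJet.ext {f : M → N} {x : M} {y : N}
    {A B : TangentSpace (𝓡 n) x ≃L[ℝ] TangentSpace (𝓡 n) y} (hA : IsOneJet f x y A)
    (hB : IsOneJet f x y B) : A = B :=
  ContinuousLinearEquiv.ext (funext fun v =>
    TotalSpace.mk_injective (F := Rn n) (E := (TangentSpace (𝓡 n) : N → Type _)) y
      ((hA v).symm.trans (hB v)))

theorem isOneJet_id (x : M) :
    IsOneJet (id : M → M) x x (ContinuousLinearEquiv.refl ℝ (TangentSpace (𝓡 n) x)) := by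
  intro v
  rw [tangentMap_id]
  rfl

theorem IsOneJet.congr {f g : M → N} {x : M} {y : N}
    {A : TangentSpace (𝓡 n) x ≃L[ℝ] TangentSpace (𝓡 n) y} (h : IsOneJet f x y A)
    (hfg : g =ᶠ[𝓝 x] f) : IsOneJet g x y A := by
  intro v
  rw [← h v]
  exact TotalSpace.ext hfg.eq_of_nhds
    (heq_of_eq (DFunLike.congr_fun (hfg.mfderiv_eq (I := 𝓡 n) (I' := 𝓡 n)) v))

theorem IsOneJet.comp {f : M → N} {g : N → L} {x : M} {y : N} {z : L}
    {A : TangentSpace (𝓡 n) x ≃L[ℝ] TangentSpace (𝓡 n) y}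
    {B : TangentSpace (𝓡 n) y ≃L[ℝ] TangentSpace (𝓡 n) z} (hB : IsOneJet g y z B)
    (hA : IsOneJet f x y A) (hg : MDifferentiableAt (𝓡 n) (𝓡 n) g y)
    (hf : MDifferentiableAt (𝓡 n) (𝓡 n) f x) : IsOneJet (g ∘ f) x z (A.trans B) := by
  intro v
  rw [tangentMap_comp_at (I' := 𝓡 n) (⟨x, v⟩ : TangentBundle (𝓡 n) M)
    (by rw [hA.apply_eq]; exact hg) hf, hA v, hB (A v)]
  rfl

theorem LocalDiffeo.isOneJet_symm (ψ : LocalDiffeo n M N) {x : M} {y : N} (hx : x ∈ ψ.source)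
    {A : TangentSpace (𝓡 n) x ≃L[ℝ] TangentSpace (𝓡 n) y} (h : IsOneJet ψ.toFun x y A) :
    IsOneJet ψ.symm.toFun y x A.symm := by
  obtain rfl : ψ.toFun x = y := h.apply_eq
  intro w
  have hc := tangentMap_comp_at (I := 𝓡 n) (I' := 𝓡 n) (I'' := 𝓡 n) (f := ψ.toFun)
    (g := ψ.symm.toFun) (⟨x, A.symm w⟩ : TangentBundle (𝓡 n) M)
    (ψ.symm.mdifferentiableAt (by simp) (ψ.map_source hx)) (ψ.mdifferentiableAt (by simp) hx)
  rw [h, A.apply_symm_apply] at hc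
  rw [← hc]
  refine ((isOneJet_id x).congr ?_) _
  filter_upwards [ψ.open_source.mem_nhds hx] with z hz
  exact ψ.left_inv hz

theorem isOneJet_translation (v u : Rn n) :
    IsOneJet (translation v).toFun u (u + v) (ContinuousLinearEquiv.refl ℝ (Rn n)) := by
  intro w
  refine TotalSpace.ext rfl (heq_of_eq ?_)
  show mfderiv (𝓡 n) (𝓡 n) (fun z : Rn n => z + v) u w = w
  rw [mfderiv_eq_fderiv]
  erw [fderiv_add_const, fderiv_fun_id]
  rfl

theorem isOneJet_linearDiffeo (B : Rn n ≃L[ℝ] Rn n) (u : Rn n) :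
    IsOneJet (linearDiffeo B).toFun u (B u) B := by
  intro w
  refine TotalSpace.ext rfl (heq_of_eq ?_)
  show mfderiv (𝓡 n) (𝓡 n) (B : Rn n → Rn n) u w = B w
  rw [mfderiv_eq_fderiv]
  erw [B.fderiv]
  rfl

theorem LocalDiffeo.isOneJet_symm_translation (ψ : LocalDiffeo n M (Rn n)) {x : M}
    (hx : x ∈ ψ.source) {A : TangentSpace (𝓡 n) x ≃L[ℝ] Rn n}
    (h : IsOneJet ψ.toFun x (ψ.toFun x) A) :
    IsOneJet ((translation (ψ.toFun x)).trans ψ.symm).toFun (0 : Rn n) x A.symm := by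
  have ht := isOneJet_translation (ψ.toFun x) (0 : Rn n)
  rw [zero_add] at ht
  exact (LocalDiffeo.isOneJet_symm ψ hx h).comp ht
    (ψ.symm.mdifferentiableAt (by simp) (ψ.map_source hx))
    ((translation (ψ.toFun x)).mdifferentiableAt (by simp) trivial)

theorem LocalDiffeo.isOneJet_chart_transition (ψ φ : LocalDiffeo n M (Rn n)) {x y : M}
    (hx : x ∈ ψ.source) (hy : y ∈ φ.source) {A : TangentSpace (𝓡 n) x ≃L[ℝ] Rn n}
    {B : TangentSpace (𝓡 n) y ≃L[ℝ] Rn n} (hA : IsOneJet ψ.toFun x (ψ.toFun x) A)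
    (hB : IsOneJet φ.toFun y (φ.toFun y) B) :
    IsOneJet ((ψ.trans (translation (φ.toFun y - ψ.toFun x))).trans φ.symm).toFun x y
      (A.trans B.symm) := by
  have ht := isOneJet_translation (φ.toFun y - ψ.toFun x) (ψ.toFun x)
  rw [add_sub_cancel] at ht
  have dψ := ψ.mdifferentiableAt (n := ∞) (by simp) hx
  have dt := (translation (φ.toFun y - ψ.toFun x)).mdifferentiableAt (n := ∞) (by simp)
    (x := ψ.toFun x) trivial
  exact (LocalDiffeo.isOneJet_symm φ hy hB).comp (ht.comp hA dt dψ)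
    (φ.symm.mdifferentiableAt (by simp) (φ.map_source hy)) (dt.comp x dψ)

end oneJets

section localDiffeo

variable {n : ℕ} {M : Type*} [TopologicalSpace M] [ChartedSpace (Rn n) M] [IsManifold (𝓡 n) ∞ M]
  {N : Type*} [TopologicalSpace N] [ChartedSpace (Rn n) N] [IsManifold (𝓡 n) ∞ N]

theorem LocalDiffeo.isOneJet_derivEquiv (ψ : LocalDiffeo n M N) {x : M} (hx : x ∈ ψ.source) :
    IsOneJet ψ.toFun x (ψ.toFun x) (LocalDiffeo.derivEquiv ψ x) := fun v =>
  TotalSpace.ext rfl (heq_of_eq (DFunLike.congr_fun (LocalDiffeo.derivEquiv_coe ψ hx) v).symm)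

end localDiffeo

/-! ### Jets of local isomorphisms of frame bundles and of their base maps -/

section baseMaps

variable {n : ℕ} {M : Type*} [TopologicalSpace M] [ChartedSpace (Rn n) M] [IsManifold (𝓡 n) ∞ M]
  {N : Type*} [TopologicalSpace N] [ChartedSpace (Rn n) N] [IsManifold (𝓡 n) ∞ N]

theorem FrameBundle.mk_injective (x : M) :
    Function.Injective (FrameBundle.mk (n := n) x) := fun a b h => by
  have h1 : (⟨x, (a : Rn n →L[ℝ] TangentSpace (𝓡 n) x)⟩ : HomBundle n M) =
      ⟨x, (b : Rn n →L[ℝ] TangentSpace (𝓡 n) x)⟩ := congrArg Subtype.val h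
  exact ContinuousLinearEquiv.coe_injective (eq_of_heq (TotalSpace.ext_iff.1 h1).2)

/-- A local isomorphism that near `X` has the form `Y ↦ F(Y, f(π Y))`, with `F` smooth, has a
`1`-jet at `X` that depends on `f` only through its `1`-jet at `π X`. -/
theorem LocalFrameIso.sameJetAt_of_factor {F : FrameBundle n M × N → FrameBundle n N}
    (hF : ContMDiff ((frameModel n).prod (𝓡 n)) (frameModel n) ∞ F)
    {Ψ Ψ' : LocalFrameIso n M N} {X : FrameBundle n M} {y : N} {f f' : M → N}
    {A : TangentSpace (𝓡 n) X.proj ≃L[ℝ] TangentSpace (𝓡 n) y}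
    (hf : IsOneJet f X.proj y A) (hf' : IsOneJet f' X.proj y A)
    (df : MDifferentiableAt (𝓡 n) (𝓡 n) f X.proj) (df' : MDifferentiableAt (𝓡 n) (𝓡 n) f' X.proj)
    (hΨ : ∀ᶠ Y in 𝓝 X, Ψ.toFun Y = F (Y, f Y.proj))
    (hΨ' : ∀ᶠ Y in 𝓝 X, Ψ'.toFun Y = F (Y, f' Y.proj)) : SameJetAt X Ψ Ψ' := by
  intro v
  have dproj : MDifferentiableAt (frameModel n) (𝓡 n) (FrameBundle.proj : FrameBundle n M → M) X :=
    FrameBundle.contMDiff_proj.mdifferentiable (by simp) X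
  have key : ∀ g : M → N, MDifferentiableAt (𝓡 n) (𝓡 n) g X.proj →
      HasMFDerivAt (frameModel n) ((frameModel n).prod (𝓡 n))
        (fun Y : FrameBundle n M => (Y, g Y.proj)) X ((ContinuousLinearMap.id ℝ _).prod
          ((mfderiv (𝓡 n) (𝓡 n) g X.proj).comp
            (mfderiv (frameModel n) (𝓡 n) FrameBundle.proj X))) := fun g hg =>
    (hasMFDerivAt_id X).prodMk (hg.hasMFDerivAt.comp X dproj.hasMFDerivAt)
  have comp : ∀ g : M → N, MDifferentiableAt (𝓡 n) (𝓡 n) g X.proj →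
      tangentMap (frameModel n) (frameModel n) (fun Y : FrameBundle n M => F (Y, g Y.proj)) ⟨X, v⟩ =
        tangentMap ((frameModel n).prod (𝓡 n)) (frameModel n) F
          (tangentMap (frameModel n) ((frameModel n).prod (𝓡 n))
            (fun Y : FrameBundle n M => (Y, g Y.proj)) ⟨X, v⟩) := fun g hg =>
    tangentMap_comp_at (I' := (frameModel n).prod (𝓡 n))
      (⟨X, v⟩ : TangentBundle (frameModel n) (FrameBundle n M))
      (hF.mdifferentiable (by simp) _) (key g hg).mdifferentiableAt
  rw [tangentMap_congr_of_eventuallyEq (p := ⟨X, v⟩) hΨ,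
    tangentMap_congr_of_eventuallyEq (p := ⟨X, v⟩) hΨ', comp f df, comp f' df']
  congr 1
  refine TotalSpace.ext ?_ (heq_of_eq ?_)
  · exact congrArg (Prod.mk X) (hf.apply_eq.trans hf'.apply_eq.symm)
  · have e : ∀ w : TangentSpace (𝓡 n) X.proj,
        (mfderiv (𝓡 n) (𝓡 n) f X.proj w : Rn n) = mfderiv (𝓡 n) (𝓡 n) f' X.proj w := fun w =>
      eq_of_heq (TotalSpace.ext_iff.1 ((hf w).trans (hf' w).symm)).2
    show mfderiv _ _ (fun Y : FrameBundle n M => (Y, f Y.proj)) X v =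
      mfderiv _ _ (fun Y : FrameBundle n M => (Y, f' Y.proj)) X v
    rw [(key f df).mfderiv, (key f' df').mfderiv]
    exact congrArg (Prod.mk v) (e _)

/-- The `1`-jet of `Ψ` at a frame over `x` determines the `1`-jet at `x` of the induced map on the
base. A smooth section through the frame serves to lift tangent vectors of `M`. -/
theorem LocalFrameIso.SameJetAt.isOneJet {Ψ Ψ' : LocalFrameIso n M N} {f f' : M → N}
    (hf : ∀ X, (Ψ.toFun X).proj = f X.proj) (hf' : ∀ X, (Ψ'.toFun X).proj = f' X.proj)
    (σ : FrameSection n M) {x : M} {y : N}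
    {A : TangentSpace (𝓡 n) x ≃L[ℝ] TangentSpace (𝓡 n) y}
    (h : SameJetAt (FrameBundle.mk x (σ.toFun x)) Ψ Ψ')
    (hΨ : FrameBundle.mk x (σ.toFun x) ∈ Ψ.source)
    (hΨ' : FrameBundle.mk x (σ.toFun x) ∈ Ψ'.source) (hA : IsOneJet f x y A) :
    IsOneJet f' x y A := by
  intro v
  rw [← hA v]
  have dσ : MDifferentiableAt (𝓡 n) (frameModel n) (fun x => FrameBundle.mk x (σ.toFun x)) x :=
    σ.smooth.mdifferentiable (by simp) x
  -- The map induced on the base is `proj ∘ Θ ∘ σ`.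
  have key : ∀ (Θ : LocalFrameIso n M N) (g : M → N), (∀ X, (Θ.toFun X).proj = g X.proj) →
      FrameBundle.mk x (σ.toFun x) ∈ Θ.source →
      tangentMap (𝓡 n) (𝓡 n) g ⟨x, v⟩ = tangentMap (frameModel n) (𝓡 n) FrameBundle.proj
        (tangentMap (frameModel n) (frameModel n) Θ.toFun
          (tangentMap (𝓡 n) (frameModel n) (fun x => FrameBundle.mk x (σ.toFun x)) ⟨x, v⟩)) := by
    intro Θ g hg hΘ
    have dΘ := Θ.mdifferentiableAt hΘ
    rw [← tangentMap_comp_at (I' := frameModel n) (⟨x, v⟩ : TangentBundle (𝓡 n) M) dΘ dσ,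
      ← tangentMap_comp_at (I' := frameModel n) (⟨x, v⟩ : TangentBundle (𝓡 n) M)
        (FrameBundle.contMDiff_proj.mdifferentiable (by simp) _) (dΘ.comp x dσ)]
    congr 1
    funext z
    exact (hg (FrameBundle.mk z (σ.toFun z))).symm
  rw [key Ψ f hf hΨ, key Ψ' f' hf' hΨ', h.apply _ rfl]

end baseMaps

/-! ### Sections of `FM` inducing a parallelism -/

section jetRep

variable {n : ℕ} {M : Type*} [TopologicalSpace M] [ChartedSpace (Rn n) M] [IsManifold (𝓡 n) ∞ M]
  {N : Type*} [TopologicalSpace N] [ChartedSpace (Rn n) N] [IsManifold (𝓡 n) ∞ N]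

theorem jetRep_mem_target (x : M) (y : N)
    (A : TangentSpace (𝓡 n) x ≃L[ℝ] TangentSpace (𝓡 n) y) : y ∈ (jetRep x y A).target := by
  have h := (jetRep x y A).map_source (jetRep_mem x y A)
  rwa [show (jetRep x y A).toPartialEquiv x = y from jetRep_apply x y A] at h

theorem jetRep_symm_apply (x : M) (y : N)
    (A : TangentSpace (𝓡 n) x ≃L[ℝ] TangentSpace (𝓡 n) y) : (jetRep x y A).invFun y = x := by
  have h := (jetRep x y A).left_inv (jetRep_mem x y A)
  rwa [show (jetRep x y A).toPartialEquiv x = y from jetRep_apply x y A] at h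

end jetRep

section gauge

variable {n : ℕ} {M : Type*} [TopologicalSpace M] [ChartedSpace (Rn n) M] [IsManifold (𝓡 n) ∞ M]

theorem OneJetSection.ext {cP cQ : OneJetSection n M} (h : ∀ x y, cP.toFun x y = cQ.toFun x y) :
    cP = cQ := by
  cases cP
  cases cQ
  congr 1
  funext x y
  exact h x y

/-- `cP` is the parallelism `(x, y) ↦ P(y) ∘ P(x)⁻¹` defined by the section `P` of `FM`. -/
def FrameSection.Induces (P : FrameSection n M) (cP : OneJetSection n M) : Prop :=
  ∀ x y : M, (P.toFun x).symm.trans (P.toFun y) = cP.toFun x y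

theorem FrameSection.Induces.isMorphism {P : FrameSection n M} {cP : OneJetSection n M}
    (h : P.Induces cP) : cP.IsMorphism := by
  intro x y z
  rw [← h x y, ← h y z, ← h x z]
  refine ContinuousLinearEquiv.ext (funext fun v => ?_)
  show P.toFun z ((P.toFun y).symm (P.toFun y _)) = P.toFun z _
  rw [ContinuousLinearEquiv.symm_apply_apply]

/-- The map `(X, y) ↦ cP(π X, y) ∘ X`, through which the lifts of `cP` factor, is smooth. -/
theorem OneJetSection.contMDiff_frame (cP : OneJetSection n M) :
    ContMDiff ((frameModel n).prod (𝓡 n)) (frameModel n) ∞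
      (fun p : FrameBundle n M × M =>
        FrameBundle.mk p.2 (p.1.toEquiv.trans (cP.toFun p.1.proj p.2))) := by
  intro p₀
  have hX := FrameBundle.contMDiffAt_iff.1
    (contMDiffAt_id (I := frameModel n) (x := p₀.1) (n := ∞))
  have hproj : ContMDiffAt ((frameModel n).prod (𝓡 n)) (𝓡 n) ∞
      (fun p : FrameBundle n M × M => p.1.proj) p₀ := hX.1.comp p₀ contMDiffAt_fst
  refine FrameBundle.contMDiffAt_iff.2 ⟨contMDiffAt_snd, ?_⟩
  have hP := (cP.smooth (p₀.1.proj, p₀.2)).comp p₀ (hproj.prodMk contMDiffAt_snd)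
  refine (hP.clm_comp (hX.2.comp p₀ contMDiffAt_fst)).congr_of_eventuallyEq ?_
  have hb := hproj.continuousAt
    ((trivializationAt (Rn n) (TangentSpace (𝓡 n)) p₀.1.proj).open_baseSet.mem_nhds
      (FiberBundle.mem_baseSet_trivializationAt' p₀.1.proj))
  filter_upwards [hb] with p hp
  simp only [FrameBundle.toEquiv_mk, FrameBundle.proj_mk]
  exact inTangentCoordinates_comp_frame (f := fun p : FrameBundle n M × M => p.1.proj)
    (g := fun p : FrameBundle n M × M => p.2) (fun p => (cP.toFun p.1.proj p.2 :
      TangentSpace (𝓡 n) p.1.proj →L[ℝ] TangentSpace (𝓡 n) p.2)) (k₀ := p₀)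
    (k := p) hp (p.1.toEquiv : Rn n →L[ℝ] TangentSpace (𝓡 n) p.1.proj)

/-- The section `x ↦ cP(x₀, x) ∘ e` of `FM` spread from a frame `e` at `x₀`. -/
noncomputable def OneJetSection.spread (cP : OneJetSection n M) (x₀ : M)
    (e : Rn n ≃L[ℝ] TangentSpace (𝓡 n) x₀) : FrameSection n M where
  toFun x := e.trans (cP.toFun x₀ x)
  smooth := by
    have h := cP.contMDiff_frame.comp
      ((contMDiff_const (c := FrameBundle.mk x₀ e)).prodMk (contMDiff_id (I := 𝓡 n)))
    simp only [Function.comp_def, id, FrameBundle.toEquiv_mk, FrameBundle.proj_mk] at h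
    exact h

theorem OneJetSection.IsMorphism.induces_spread {cP : OneJetSection n M} (h : cP.IsMorphism)
    (x₀ : M) (e : Rn n ≃L[ℝ] TangentSpace (𝓡 n) x₀) : (cP.spread x₀ e).Induces cP := by
  intro x y
  refine ContinuousLinearEquiv.ext (funext fun v => ?_)
  show cP.toFun x₀ y (e (e.symm ((cP.toFun x₀ x).symm v))) = _
  rw [ContinuousLinearEquiv.apply_symm_apply, ← h x₀ x y]
  show cP.toFun x y (cP.toFun x₀ x ((cP.toFun x₀ x).symm v)) = _
  rw [ContinuousLinearEquiv.apply_symm_apply]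

theorem OneJetSection.lift_proj (cP : OneJetSection n M) (ψ : LocalDiffeo n M M)
    (X : FrameBundle n M) : ((cP.lift ψ).toFun X).proj = ψ.toFun X.proj := rfl

theorem OneJetSection.lift_mk (cP : OneJetSection n M) (ψ : LocalDiffeo n M M) {x y : M}
    (hy : ψ.toFun x = y) (e : Rn n ≃L[ℝ] TangentSpace (𝓡 n) x) :
    (cP.lift ψ).toFun (FrameBundle.mk x e) = FrameBundle.mk y (e.trans (cP.toFun x y)) := by
  subst hy
  show FrameBundle.mk (ψ.toFun x)
    ((FrameBundle.mk x e).toEquiv.trans (cP.toFun x (ψ.toFun x))) = _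
  rw [FrameBundle.toEquiv_mk]
  rfl

/-- The representative `X ↦ P(f v) ∘ P(v)⁻¹ ∘ X` of `P̄(y) · P̄(x)⁻¹`, where `f = φ ∘ ψ⁻¹` and
`v = π X`. -/
theorem FrameSection.comp_symm_lift_apply (P : FrameSection n M) (ψ φ : LocalDiffeo n (Rn n) M)
    {X : FrameBundle n M} (hX : X.proj ∈ ψ.target) :
    ((P.lift φ).comp (P.lift ψ).symm).toFun X = FrameBundle.mk (φ.toFun (ψ.invFun X.proj))
      (X.toEquiv.trans ((P.toFun X.proj).symm.trans (P.toFun (φ.toFun (ψ.invFun X.proj))))) := by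
  have key : ∀ x, x = X.proj → FrameBundle.mk (φ.toFun (ψ.invFun X.proj))
      (ContinuousLinearEquiv.trans (M₂ := Rn n) (ContinuousLinearEquiv.trans (M₂ := Rn n) X.toEquiv
        (P.toFun x).symm) (P.toFun (φ.toFun (ψ.invFun X.proj)))) =
      FrameBundle.mk (φ.toFun (ψ.invFun X.proj))
      (X.toEquiv.trans ((P.toFun X.proj).symm.trans
        (P.toFun (φ.toFun (ψ.invFun X.proj))))) := by
    rintro _ rfl
    rfl
  refine Eq.trans ?_ (key _ (ψ.right_inv hX))
  show FrameBundle.mk (φ.toFun (ψ.invFun X.proj)) (ContinuousLinearEquiv.trans (M₂ := Rn n)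
    (FrameBundle.mk (ψ.invFun X.proj) (ContinuousLinearEquiv.trans (M₂ := Rn n) X.toEquiv
      (P.toFun (ψ.toFun (ψ.invFun X.proj))).symm)).toEquiv
    (P.toFun (φ.toFun (ψ.invFun X.proj)))) = _
  rw [FrameBundle.toEquiv_mk]
  rfl

theorem FrameSection.isOneJet_transition (Q : FrameSection n M) (x y : M) :
    IsOneJet ((jetRep (0 : Rn n) y (Q.toFun y)).toFun ∘ (jetRep (0 : Rn n) x (Q.toFun x)).symm.toFun)
      x y ((Q.toFun x).symm.trans (Q.toFun y)) := by
  exact (jetRep_isOneJet (0 : Rn n) y (Q.toFun y)).comp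
    (LocalDiffeo.isOneJet_symm _ (jetRep_mem _ _ _) (jetRep_isOneJet (0 : Rn n) x (Q.toFun x)))
    ((jetRep (0 : Rn n) y (Q.toFun y)).mdifferentiableAt (by simp) (jetRep_mem _ _ _))
    ((jetRep (0 : Rn n) x (Q.toFun x)).symm.mdifferentiableAt (by simp)
      (jetRep_mem_target _ _ _))

theorem gaugeMap_prolongation_eq {P Q : FrameSection n M} {cP cQ : OneJetSection n M}
    (hP : P.Induces cP) (hQ : Q.Induces cQ) :
    gaugeMap (P.prolongation Q) = cP.prolongation cQ := by
  funext x y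
  refine Quotient.sound (s := frameJetSetoid n M x y) fun X hX => ?_
  subst hX
  set x := X.proj
  have hx := jetRep_mem_target (0 : Rn n) x (Q.toFun x)
  have hj := Q.isOneJet_transition x y
  rw [hQ x y] at hj
  refine LocalFrameIso.sameJetAt_of_factor cP.contMDiff_frame hj (jetRep_isOneJet x y _)
    (MDifferentiableAt.comp x (I' := 𝓡 n) ((jetRep (0 : Rn n) y (Q.toFun y)).mdifferentiableAt
      (by simp) ?_) ((jetRep (0 : Rn n) x (Q.toFun x)).symm.mdifferentiableAt (by simp) hx))
    ((jetRep x y (cQ.toFun x y)).mdifferentiableAt (by simp) (jetRep_mem _ _ _)) ?_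
    (Filter.Eventually.of_forall fun Y => rfl)
  · show (jetRep (0 : Rn n) x (Q.toFun x)).invFun x ∈ _
    rw [show (jetRep (0 : Rn n) x (Q.toFun x)).invFun x = 0 from jetRep_symm_apply _ _ _]
    exact jetRep_mem _ _ _
  · filter_upwards [FrameBundle.contMDiff_proj.continuous.continuousAt
      ((jetRep (0 : Rn n) x (Q.toFun x)).open_target.mem_nhds hx)] with Y hY
    refine (P.comp_symm_lift_apply _ _ hY).trans ?_
    rw [hP]
    rfl

/-- If `𝒫¹(𝒬)(x,y)` is the jet of `Θ`, then `Θ` acts on the frames at `x` by `𝒫(x,y)` and the map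
`f` it induces on the base has `1`-jet `𝒬(x,y)`. -/
theorem OneJetSection.of_prolongation_eq (cP cQ : OneJetSection n M) {x y : M}
    {Θ : LocalFrameIso n M M} {f : M → M} (hΘ : Θ.IsOver x y)
    (hf : ∀ X, (Θ.toFun X).proj = f X.proj)
    (h : cP.prolongation cQ x y = Quotient.mk (frameJetSetoid n M x y) ⟨Θ, hΘ⟩) :
    (∀ e : Rn n ≃L[ℝ] TangentSpace (𝓡 n) x,
      Θ.toFun (FrameBundle.mk x e) = FrameBundle.mk y (e.trans (cP.toFun x y))) ∧
      IsOneJet f x y (cQ.toFun x y) := by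
  have hs : ∀ X : FrameBundle n M, X.proj = x →
      LocalFrameIso.SameJetAt X (cP.lift (jetRep x y (cQ.toFun x y))) Θ := Quotient.exact h
  refine ⟨fun e => ?_, ?_⟩
  · rw [← (hs (FrameBundle.mk x e) rfl).map_eq]
    exact cP.lift_mk _ (jetRep_apply _ _ _) e
  · exact LocalFrameIso.SameJetAt.isOneJet (cP.lift_proj _) hf
      (cP.spread x (ContinuousLinearEquiv.refl ℝ (Rn n))) (hs _ rfl) (jetRep_mem x y _)
      (hΘ _ rfl).1 (jetRep_isOneJet x y (cQ.toFun x y))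

theorem induces_of_gaugeMap_prolongation_eq {P Q : FrameSection n M} {cP cQ : OneJetSection n M}
    (h : gaugeMap (P.prolongation Q) = cP.prolongation cQ) : P.Induces cP ∧ Q.Induces cQ := by
  have key := fun x y : M => cP.of_prolongation_eq cQ _
    (f := (jetRep (0 : Rn n) y (Q.toFun y)).toFun ∘ (jetRep (0 : Rn n) x (Q.toFun x)).symm.toFun)
    (fun X => rfl) (congrFun (congrFun h x) y).symm
  refine ⟨fun x y => ?_, fun x y => (Q.isOneJet_transition x y).ext (key x y).2⟩
  have hx := jetRep_mem_target (0 : Rn n) x (Q.toFun x)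
  have hv := (P.comp_symm_lift_apply _ (jetRep (0 : Rn n) y (Q.toFun y))
    (X := FrameBundle.mk x (P.toFun x)) hx).symm.trans ((key x y).1 (P.toFun x))
  have hy : (jetRep (0 : Rn n) y (Q.toFun y)).toFun ((jetRep (0 : Rn n) x (Q.toFun x)).invFun x)
      = y := (Q.isOneJet_transition x y).apply_eq
  have key2 : ∀ z, z = y → FrameBundle.mk z ((P.toFun x).trans ((P.toFun x).symm.trans
      (P.toFun z))) = FrameBundle.mk y ((P.toFun x).trans (cP.toFun x y)) →
      (P.toFun x).symm.trans (P.toFun y) = cP.toFun x y := by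
    rintro _ rfl h
    have h' := FrameBundle.mk_injective _ h
    refine ContinuousLinearEquiv.ext (funext fun v => ?_)
    simpa using DFunLike.congr_fun h' ((P.toFun x).symm v)
  refine key2 _ hy ?_
  rw [← hv]
  simp only [FrameBundle.toEquiv_mk, FrameBundle.proj_mk]
  rfl

end gauge

/-! ### Integrability -/

section integrability

variable {n : ℕ} {M : Type*} [TopologicalSpace M] [ChartedSpace (Rn n) M] [IsManifold (𝓡 n) ∞ M]

theorem OneJetSection.IsIntegrable.spread {cQ : OneJetSection n M} (h : cQ.IsIntegrable) (x₀ : M)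
    (e : Rn n ≃L[ℝ] TangentSpace (𝓡 n) x₀) : (cQ.spread x₀ e).IsIntegrable := by
  intro z
  obtain ⟨ψ, φ, hx₀, hz, hψφ⟩ := h.2 x₀ z
  have hψ := LocalDiffeo.isOneJet_derivEquiv ψ hx₀
  set A : TangentSpace (𝓡 n) x₀ ≃L[ℝ] Rn n := LocalDiffeo.derivEquiv ψ x₀
  -- `Q(y) = C⁻¹ ∘ A ∘ e` with `C = T_yφ`, so `B ∘ φ` is the chart that integrates `Q` near `z`.
  let B : Rn n ≃L[ℝ] Rn n := (e.trans A).symm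
  refine ⟨φ.trans (linearDiffeo B), ⟨hz, trivial⟩, fun y hy => ?_⟩
  have hφ := LocalDiffeo.isOneJet_derivEquiv φ hy.1
  set C : TangentSpace (𝓡 n) y ≃L[ℝ] Rn n := LocalDiffeo.derivEquiv φ y
  have hQ : cQ.toFun x₀ y = A.trans C.symm := (hψφ x₀ hx₀ y hy.1).ext
    (LocalDiffeo.isOneJet_chart_transition ψ φ hx₀ hy.1 hψ hφ)
  have hc : IsOneJet (φ.trans (linearDiffeo B)).toFun y ((φ.trans (linearDiffeo B)).toFun y)
      (C.trans B) := (isOneJet_linearDiffeo B (φ.toFun y)).comp hφ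
    ((linearDiffeo B).mdifferentiableAt (by simp) trivial) (φ.mdifferentiableAt (by simp) hy.1)
  have hs : (cQ.spread x₀ e).toFun y = (C.trans B).symm := by
    show e.trans (cQ.toFun x₀ y) = _
    rw [hQ]
    rfl
  rw [hs]
  exact LocalDiffeo.isOneJet_symm_translation _ hy hc

/-- The map `(X, y) ↦ P(y) ∘ X`, through which the lifts of `P` factor, is smooth. -/
theorem FrameSection.contMDiff_frame (P : FrameSection n M) :
    ContMDiff ((frameModel n).prod (𝓡 n)) (frameModel n) ∞
      (fun p : FrameBundle n (Rn n) × M =>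
        FrameBundle.mk p.2 (ContinuousLinearEquiv.trans (M₂ := Rn n) p.1.toEquiv
          (P.toFun p.2))) := by
  intro p₀
  have hX := FrameBundle.contMDiffAt_iff.1
    (contMDiffAt_id (I := frameModel n) (x := p₀.1) (n := ∞))
  have hP := (FrameBundle.contMDiffAt_iff.1 (P.smooth p₀.2)).2.comp p₀
    (contMDiffAt_snd (I := frameModel n) (J := 𝓡 n))
  refine FrameBundle.contMDiffAt_iff.2 ⟨contMDiffAt_snd, ?_⟩
  refine (hP.clm_comp (hX.2.comp p₀ contMDiffAt_fst)).congr_of_eventuallyEq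
    (Filter.Eventually.of_forall fun p => ?_)
  simp only [FrameBundle.toEquiv_mk, FrameBundle.proj_mk, Function.comp, id]
  erw [TangentBundle.continuousLinearMapAt_model_space]
  rfl

/-- If `ψ` integrates `Q`, then `θ = ψ⁻¹ ∘ τ_{ψ(x)}` satisfies `T_vθ = Q(θ(v))` at every `v` near
`0`, not only at `0`, so that `Fθ` is the lift of `θ` by `Q`. -/
theorem FrameSection.IsIntegrable.isIntegrableFrame {Q : FrameSection n M} (h : Q.IsIntegrable) :
    IsIntegrableFrame (Q.prolongation Q) := by
  intro z
  obtain ⟨ψ, hz, hψ⟩ := h z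
  refine ⟨ψ, hz, fun x hx => ?_⟩
  set θ := (translation (ψ.toFun x)).trans ψ.symm with hθ
  have h0 : (0 : Rn n) ∈ θ.source := by
    refine ⟨trivial, ?_⟩
    show 0 + ψ.toFun x ∈ ψ.target
    rw [zero_add]
    exact ψ.map_source hx
  have hover : (frameLift θ).IsOver 0 x := by
    intro X hX
    refine ⟨?_, ?_⟩
    · show X.proj ∈ θ.source
      rw [hX]
      exact h0
    · show θ.toFun X.proj = x
      rw [hX]
      exact (hψ x hx).apply_eq
  refine ⟨hover, Quotient.sound (s := nonholonomicFrameSetoid n M x) ?_⟩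
  refine LocalFrameIso.sameJetAt_of_factor Q.contMDiff_frame (jetRep_isOneJet (0 : Rn n) x _)
    (hψ x hx) ((jetRep (0 : Rn n) x _).mdifferentiableAt (by simp) (jetRep_mem _ _ _))
    (θ.mdifferentiableAt (by simp) h0) (Filter.Eventually.of_forall fun Y => rfl) ?_
  filter_upwards [FrameBundle.contMDiff_proj.continuous.continuousAt
    (θ.open_source.mem_nhds h0)] with Y hY
  show FrameBundle.mk (θ.toFun Y.proj) (Y.toEquiv.trans (LocalDiffeo.derivEquiv θ Y.proj)) =
    FrameBundle.mk (θ.toFun Y.proj) (ContinuousLinearEquiv.trans (M₂ := Rn n) Y.toEquiv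
      (Q.toFun (θ.toFun Y.proj)))
  have key : LocalDiffeo.derivEquiv θ Y.proj = Q.toFun (θ.toFun Y.proj) := by
    have hw : θ.toFun Y.proj ∈ ψ.source := ψ.map_target hY.2
    have hY' : Y.proj + (ψ.toFun x - ψ.toFun (θ.toFun Y.proj)) = 0 := by
      have hr : ψ.toFun (θ.toFun Y.proj) = Y.proj + ψ.toFun x := ψ.right_inv hY.2
      rw [hr]
      abel
    -- With `w = θ (π Y)`, the map `θ` is `ψ⁻¹ ∘ τ_{ψ(w)}` after the translation taking `π Y` to `0`.
    have ht := isOneJet_translation (ψ.toFun x - ψ.toFun (θ.toFun Y.proj)) Y.proj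
    have hc := (hψ _ hw).comp (hY' ▸ ht) (PartialDiffeomorph.mdifferentiableAt _ (by simp) ?_)
      ((translation _).mdifferentiableAt (by simp) trivial)
    refine (LocalDiffeo.isOneJet_derivEquiv θ hY).ext (hc.congr
      (Filter.Eventually.of_forall fun v => ?_))
    · show ψ.invFun (v + ψ.toFun x) = ψ.invFun (v + (ψ.toFun x - ψ.toFun (θ.toFun Y.proj)) +
        ψ.toFun (θ.toFun Y.proj))
      congr 1
      abel
    · refine ⟨trivial, ?_⟩
      show 0 + ψ.toFun (θ.toFun Y.proj) ∈ ψ.target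
      rw [zero_add]
      exact ψ.map_source hw
  rw [key]
  rfl

theorem frameLift_mk (θ : LocalDiffeo n M M) {x : M} (e : Rn n ≃L[ℝ] TangentSpace (𝓡 n) x) :
    (frameLift θ).toFun (FrameBundle.mk x e) =
      FrameBundle.mk (θ.toFun x) (e.trans (LocalDiffeo.derivEquiv θ x)) := by
  show FrameBundle.mk (θ.toFun x)
    ((FrameBundle.mk x e).toEquiv.trans (LocalDiffeo.derivEquiv θ x)) = _
  rw [FrameBundle.toEquiv_mk]
  rfl

/-- Integrability of `𝒫¹(𝒬)` as a section of `J̃¹(FM)` forces both `𝒫(x,y)` and `𝒬(x,y)` to be the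
tangent map of the same transition `φ⁻¹ ∘ τ ∘ ψ`. -/
theorem OneJetSection.of_isIntegrableJet {cP cQ : OneJetSection n M}
    (h : IsIntegrableJet (cP.prolongation cQ)) : cP = cQ ∧ cQ.IsIntegrable := by
  have hjet : ∀ {x y : M} (θ : LocalDiffeo n M M),
      (cP.prolongation cQ x y).IsJetOf (frameLift θ) → IsOneJet θ.toFun x y (cQ.toFun x y) ∧
        cP.toFun x y = cQ.toFun x y := by
    rintro x y θ ⟨hover, hj⟩
    obtain ⟨hv, hb⟩ := cP.of_prolongation_eq cQ hover (f := θ.toFun) (fun X => rfl) hj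
    refine ⟨hb, ?_⟩
    have hx : x ∈ θ.source :=
      (hover (FrameBundle.mk x (ContinuousLinearEquiv.refl ℝ (Rn n))) rfl).1
    obtain rfl : θ.toFun x = y := hb.apply_eq
    rw [hb.ext (LocalDiffeo.isOneJet_derivEquiv θ hx)]
    obtain ⟨e⟩ : Nonempty (Rn n ≃L[ℝ] TangentSpace (𝓡 n) x) :=
      ⟨ContinuousLinearEquiv.refl ℝ (Rn n)⟩
    have he := FrameBundle.mk_injective _ ((frameLift_mk θ e).symm.trans (hv e))
    refine ContinuousLinearEquiv.ext (funext fun v => ?_)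
    simpa using (DFunLike.congr_fun he (e.symm v)).symm
  refine ⟨OneJetSection.ext fun x y => ?_, fun x y z => ?_, fun x₀ y₀ => ?_⟩
  · obtain ⟨ψ, φ, hx, hy, hψφ⟩ := h.2 x y
    exact (hjet _ (hψφ x hx y hy)).2
  · have hb := (cP.of_prolongation_eq cQ _
      (f := (jetRep y z (cQ.toFun y z)).toFun ∘ (jetRep x y (cQ.toFun x y)).toFun)
      (fun X => rfl) (h.1 x y z).symm).2
    exact ((jetRep_isOneJet y z (cQ.toFun y z)).comp (jetRep_isOneJet x y (cQ.toFun x y))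
      ((jetRep y z (cQ.toFun y z)).mdifferentiableAt (by simp) (jetRep_mem _ _ _))
      ((jetRep x y (cQ.toFun x y)).mdifferentiableAt (by simp) (jetRep_mem _ _ _))).ext hb
  · obtain ⟨ψ, φ, hx, hy, hψφ⟩ := h.2 x₀ y₀
    exact ⟨ψ, φ, hx, hy, fun x hx y hy => (hjet _ (hψφ x hx y hy)).1⟩

theorem OneJetSection.IsMorphism.exists_induces {cP : OneJetSection n M} (h : cP.IsMorphism) :
    ∃ P : FrameSection n M, P.Induces cP ∧ (cP.IsIntegrable → P.IsIntegrable) := by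
  rcases isEmpty_or_nonempty M with hM | ⟨⟨x₀⟩⟩
  · exact ⟨⟨fun x => isEmptyElim x, fun x => isEmptyElim x⟩, fun x => isEmptyElim x,
      fun _ x => isEmptyElim x⟩
  · exact ⟨cP.spread x₀ (ContinuousLinearEquiv.refl ℝ (Rn n)), h.induces_spread x₀ _,
      fun hi => hi.spread x₀ _⟩

end integrability

theorem mainTheorem8 (n : ℕ) (M : Type*) [TopologicalSpace M] [ChartedSpace (Rn n) M]
    [IsManifold (𝓡 n) ∞ M] (cP cQ : OneJetSection n M) :
    ((∃ P Q : FrameSection n M, gaugeMap (P.prolongation Q) = cP.prolongation cQ) ↔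
      cP.IsMorphism ∧ cQ.IsMorphism) ∧
    (IsIntegrableJet (cP.prolongation cQ) →
      ∃ P Q : FrameSection n M, IsIntegrableFrame (P.prolongation Q) ∧
        gaugeMap (P.prolongation Q) = cP.prolongation cQ) ∧
    (cQ.IsIntegrable →
      ((∃ P Q : FrameSection n M, Q.IsIntegrable ∧
        gaugeMap (P.prolongation Q) = cP.prolongation cQ) ↔ cP.IsMorphism)) := by
  refine ⟨⟨?_, ?_⟩, fun h => ?_, fun hi => ⟨?_, fun hP => ?_⟩⟩
  · rintro ⟨P, Q, h⟩
    obtain ⟨hP, hQ⟩ := induces_of_gaugeMap_prolongation_eq h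
    exact ⟨hP.isMorphism, hQ.isMorphism⟩
  · rintro ⟨hP, hQ⟩
    obtain ⟨P, hP, -⟩ := hP.exists_induces
    obtain ⟨Q, hQ, -⟩ := hQ.exists_induces
    exact ⟨P, Q, gaugeMap_prolongation_eq hP hQ⟩
  · obtain ⟨rfl, hi⟩ := OneJetSection.of_isIntegrableJet h
    obtain ⟨Q, hQ, hQi⟩ := hi.1.exists_induces
    exact ⟨Q, Q, (hQi hi).isIntegrableFrame, gaugeMap_prolongation_eq hQ hQ⟩
  · rintro ⟨P, Q, -, h⟩
    exact (induces_of_gaugeMap_prolongation_eq h).1.isMorphism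
  · obtain ⟨P, hP, -⟩ := hP.exists_induces
    obtain ⟨Q, hQ, hQi⟩ := hi.1.exists_induces
    exact ⟨P, Q, hQi hi, gaugeMap_prolongation_eq hP hQ⟩
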